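/- Let $\mathcal{MV}$ be the category of all MV-algebras $(A,\oplus,{}^*,0)$ and their homomorphisms, and let $\mathcal{MV}^{\mathrm{ss}}$ be its full subcategory of semisimple algebras (subdirect products of simple ones). For an MV-algebra $A$ let $\operatorname{Max}A$ be its set of maximal ideals and $\operatorname{Rad}A$ their intersection. For $M\in\operatorname{Max}A$ let $\iota_M\colon A/M\to[0,1]$ be the unique embedding of MV-algebras, and for $a\in A$ let $\widehat a\in[0,1]^{\operatorname{Max}A}$ be given by $\widehat a(M)=\iota_M(a/M)$. A cut of $A$ is a subset $X\subseteq A$ which is the set of all lower bounds of the set $uX$ of its upper bounds. A cut $X$ of a semisimple $A$ is a limit cut if $\bigwedge\{\widehat b\ominus\widehat a \mid a\in X,\ b\in uX\}=0$ in $[0,1]^{\operatorname{Max}A}$. A semisimple $A$ is limit cut complete if every limit cut of $A$ has a supremum in $A$; let $\mathcal{MV}^{\mathrm{lcc}}$ be the full subcategory of these algebras. For semisimple $A$, let $A^{\mathrm{lcc}}$ be the intersection of all limit cut complete subalgebras of $[0,1]^{\operatorname{Max}A}$ that contain $\widehat a$ for every $a\in A$. Then $\mathcal{MV}^{\mathrm{lcc}}$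 is a reflective subcategory of $\mathcal{MV}$. More precisely, the inclusion $\mathcal{MV}^{\mathrm{ss}}\to\mathcal{MV}$ has a left adjoint $S$ with, up to isomorphism, $S(A)=A/\operatorname{Rad}A$ and unit the canonical projection $A\to A/\operatorname{Rad}A$; the inclusion $\mathcal{MV}^{\mathrm{lcc}}\to\mathcal{MV}^{\mathrm{ss}}$ has a left adjoint $K$ with, up to isomorphism, $K(A)=A^{\mathrm{lcc}}$ and unit $a\mapsto\widehat a$; and the composite $K\circ S$ is left adjoint to the inclusion $\mathcal{MV}^{\mathrm{lcc}}\to\mathcal{MV}$, with unit the composite of the two units. -/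

import Mathlib

open CategoryTheory

universe u v

/-- An MV-algebra `(A, ⊕, *, 0)` (Chang, in Mangani's axiomatisation). The partial order is the
natural one of an MV-algebra: it is determined by the operations through `le_iff`. -/
class MVAlgebra (A : Type u) extends PartialOrder A where
  /-- the truncated sum `x ⊕ y` -/
  oplus : A → A → A
  /-- the involution `x*` -/
  neg : A → A
  /-- the constant `0` -/
  zero : A
  oplus_assoc : ∀ x y z : A, oplus (oplus x y) z = oplus x (oplus y z)
  oplus_comm : ∀ x y : A, oplus x y = oplus y x
  oplus_zero : ∀ x : A, oplus x zero = x
  neg_neg : ∀ x : A, neg (neg x) = x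
  oplus_one : ∀ x : A, oplus x (neg zero) = neg zero
  lukasiewicz : ∀ x y : A, oplus (neg (oplus (neg x) y)) y = oplus (neg (oplus (neg y) x)) x
  le_iff : ∀ x y : A, x ≤ y ↔ oplus (neg x) y = neg zero

namespace MVAlgebra

infixl:65 " ⊕ₘ " => MVAlgebra.oplus

section Basic

variable {A : Type u} [MVAlgebra A]

/-- The constant `1 = 0*`. -/
def one : A := neg (zero : A)

/-- The difference `x ⊖ y = x ⊙ y* = (x* ⊕ y)*`. -/
def ominus (x y : A) : A := neg (neg x ⊕ₘ y)

end Basic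

section OfAxioms

variable {A : Type u} (oplus : A → A → A) (neg : A → A) (zero : A)
  (oplus_assoc : ∀ x y z : A, oplus (oplus x y) z = oplus x (oplus y z))
  (oplus_comm : ∀ x y : A, oplus x y = oplus y x)
  (oplus_zero : ∀ x : A, oplus x zero = x)
  (neg_neg : ∀ x : A, neg (neg x) = x)
  (oplus_one : ∀ x : A, oplus x (neg zero) = neg zero)
  (lukasiewicz : ∀ x y : A, oplus (neg (oplus (neg x) y)) y = oplus (neg (oplus (neg y) x)) x)

/-- An MV-algebra is given by its three operations and the six equations; the order comes for
free. -/
abbrev ofAxioms : MVAlgebra A where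
  le x y := oplus (neg x) y = neg zero
  le_refl x := by
    have h := lukasiewicz x (neg zero)
    rw [oplus_one, neg_neg, oplus_comm zero x, oplus_zero] at h
    exact h.symm
  le_trans x y z hxy hyz := by
    have h := lukasiewicz y z
    rw [hyz, neg_neg, oplus_comm zero z, oplus_zero] at h
    change oplus (neg x) z = neg zero
    rw [h, oplus_comm _ y, ← oplus_assoc, hxy, oplus_comm, oplus_one]
  le_antisymm x y hxy hyx := by
    have h := lukasiewicz x y
    rw [hxy, hyx, neg_neg, oplus_comm zero y, oplus_comm zero x, oplus_zero, oplus_zero] at h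
    exact h.symm
  oplus := oplus
  neg := neg
  zero := zero
  oplus_assoc := oplus_assoc
  oplus_comm := oplus_comm
  oplus_zero := oplus_zero
  neg_neg := neg_neg
  oplus_one := oplus_one
  lukasiewicz := lukasiewicz
  le_iff _ _ := Iff.rfl

end OfAxioms

section Lemmas

variable {A : Type u} [MVAlgebra A]

theorem oplus_le_oplus {a b c d : A} (hab : a ≤ b) (hcd : c ≤ d) : a ⊕ₘ c ≤ b ⊕ₘ d := by
  have key : ∀ x y : A, x ≤ y → ∃ z, y = x ⊕ₘ z := by
    intro x y h
    have h1 := lukasiewicz x y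
    rw [(le_iff x y).1 h, neg_neg, oplus_comm zero y, oplus_zero] at h1
    exact ⟨_, h1.trans (oplus_comm _ _)⟩
  obtain ⟨z, rfl⟩ := key _ _ hab
  obtain ⟨w, rfl⟩ := key _ _ hcd
  rw [le_iff]
  have h2 : a ⊕ₘ z ⊕ₘ (c ⊕ₘ w) = (a ⊕ₘ c) ⊕ₘ (z ⊕ₘ w) := by
    rw [oplus_assoc, oplus_assoc, ← oplus_assoc z, oplus_comm z c, oplus_assoc c]
  rw [h2, ← oplus_assoc, (le_iff _ _).1 (le_refl (a ⊕ₘ c)), oplus_comm, oplus_one]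

theorem ominus_le_iff (a b c : A) : ominus a b ≤ c ↔ a ≤ b ⊕ₘ c := by
  rw [le_iff, le_iff, ominus, neg_neg, oplus_assoc]

end Lemmas

/-- The standard MV-algebra on the real unit interval: `x ⊕ y = min (1, x + y)`, `x* = 1 - x`. -/
noncomputable instance : MVAlgebra unitInterval where
  oplus x y := ⟨min 1 ((x : ℝ) + y),
    le_min zero_le_one (add_nonneg x.2.1 y.2.1), min_le_left _ _⟩
  neg x := unitInterval.symm x
  zero := 0
  oplus_assoc x y z := by
    have hx := x.2.1; have hy := y.2.1; have hz := z.2.1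
    apply Subtype.ext
    change min 1 (min 1 ((x : ℝ) + y) + z) = min 1 ((x : ℝ) + min 1 ((y : ℝ) + z))
    grind
  oplus_comm x y := by
    apply Subtype.ext
    change min 1 ((x : ℝ) + y) = min 1 ((y : ℝ) + x)
    rw [add_comm]
  oplus_zero x := by
    have hx := x.2.2
    apply Subtype.ext
    change min 1 ((x : ℝ) + (0 : ℝ)) = x
    grind
  neg_neg x := unitInterval.symm_symm x
  oplus_one x := by
    have hx := x.2.1
    apply Subtype.ext
    change min 1 ((x : ℝ) + (1 - 0 : ℝ)) = 1 - 0
    grind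
  lukasiewicz x y := by
    have hx := x.2.1; have hy := y.2.1; have hx2 := x.2.2; have hy2 := y.2.2
    apply Subtype.ext
    change min 1 ((1 - min 1 ((1 - x : ℝ) + y)) + (y : ℝ))
      = min 1 ((1 - min 1 ((1 - y : ℝ) + x)) + (x : ℝ))
    grind
  le_iff x y := by
    have hx := x.2.1; have hy := y.2.1; have hx2 := x.2.2; have hy2 := y.2.2
    rw [Subtype.ext_iff]
    change (x : ℝ) ≤ y ↔ min 1 ((1 - x : ℝ) + y) = 1 - 0
    grind

/-- Products of MV-algebras, with pointwise operations and pointwise order. -/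
instance {X : Type v} {S : X → Type u} [∀ i, MVAlgebra (S i)] : MVAlgebra (∀ i, S i) where
  oplus f g i := f i ⊕ₘ g i
  neg f i := neg (f i)
  zero _ := zero
  oplus_assoc _ _ _ := funext fun _ => oplus_assoc _ _ _
  oplus_comm _ _ := funext fun _ => oplus_comm _ _
  oplus_zero _ := funext fun _ => oplus_zero _
  neg_neg _ := funext fun _ => neg_neg _
  oplus_one _ := funext fun _ => oplus_one _
  lukasiewicz _ _ := funext fun _ => lukasiewicz _ _
  le_iff f g := by
    rw [Pi.le_def, funext_iff]
    exact forall_congr' fun i => le_iff (f i) (g i)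

end MVAlgebra

open MVAlgebra

/-- Homomorphisms of MV-algebras. -/
@[ext]
structure MVHom (A : Type u) (B : Type v) [MVAlgebra A] [MVAlgebra B] where
  toFun : A → B
  map_zero : toFun zero = zero
  map_oplus : ∀ x y, toFun (x ⊕ₘ y) = toFun x ⊕ₘ toFun y
  map_neg : ∀ x, toFun (neg x) = neg (toFun x)

instance (A : Type u) (B : Type v) [MVAlgebra A] [MVAlgebra B] :
    CoeFun (MVHom A B) (fun _ => A → B) := ⟨MVHom.toFun⟩

/-- An MV-algebra, bundled with its carrier. -/
structure MVAlg : Type (u + 1) where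
  carrier : Type u
  [str : MVAlgebra carrier]

attribute [instance] MVAlg.str

instance : CoeSort MVAlg.{u} (Type u) := ⟨MVAlg.carrier⟩

/-- The category of all MV-algebras and MV-algebra homomorphisms. -/
instance : Category MVAlg.{u} where
  Hom A B := MVHom A B
  id A := ⟨id, rfl, fun _ _ => rfl, fun _ => rfl⟩
  comp f g :=
    { toFun := fun a => g.toFun (f.toFun a)
      map_zero := by rw [f.map_zero, g.map_zero]
      map_oplus := fun x y => by rw [f.map_oplus, g.map_oplus]
      map_neg := fun x => by rw [f.map_neg, g.map_neg] }

/-- The map underlying a morphism of MV-algebras. -/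
def MVAlg.map {A B : MVAlg.{u}} (f : A ⟶ B) : A → B := MVHom.toFun f

/-- Subalgebras of an MV-algebra. -/
structure MVSubalgebra (A : Type u) [MVAlgebra A] where
  carrier : Set A
  zero_mem : zero ∈ carrier
  oplus_mem : ∀ x y, x ∈ carrier → y ∈ carrier → x ⊕ₘ y ∈ carrier
  neg_mem : ∀ x, x ∈ carrier → neg x ∈ carrier

/-- A subalgebra is an MV-algebra under the restricted operations. -/
instance {A : Type u} [MVAlgebra A] (B : MVSubalgebra A) : MVAlgebra B.carrier where
  oplus x y := ⟨x.1 ⊕ₘ y.1, B.oplus_mem _ _ x.2 y.2⟩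
  neg x := ⟨neg x.1, B.neg_mem _ x.2⟩
  zero := ⟨zero, B.zero_mem⟩
  oplus_assoc _ _ _ := Subtype.ext (oplus_assoc _ _ _)
  oplus_comm _ _ := Subtype.ext (oplus_comm _ _)
  oplus_zero _ := Subtype.ext (oplus_zero _)
  neg_neg _ := Subtype.ext (neg_neg _)
  oplus_one _ := Subtype.ext (oplus_one _)
  lukasiewicz _ _ := Subtype.ext (lukasiewicz _ _)
  le_iff x y := by
    rw [Subtype.ext_iff]
    exact le_iff x.1 y.1

/-- Ideals of an MV-algebra: downward closed submonoids for `⊕`. -/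
@[ext]
structure MVIdeal (A : Type u) [MVAlgebra A] where
  carrier : Set A
  zero_mem : zero ∈ carrier
  oplus_mem : ∀ x y, x ∈ carrier → y ∈ carrier → x ⊕ₘ y ∈ carrier
  mem_of_le : ∀ x y, x ≤ y → y ∈ carrier → x ∈ carrier

namespace MVIdeal

variable {A : Type u} [MVAlgebra A]

/-- Proper ideals. -/
def IsProper (I : MVIdeal A) : Prop := I.carrier ≠ Set.univ

/-- Maximal ideals: maximal among the proper ideals. -/
def IsMaximal (I : MVIdeal A) : Prop :=
  I.IsProper ∧ ∀ J : MVIdeal A, J.IsProper → I.carrier ⊆ J.carrier → J.carrier = I.carrier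

/-- The congruence of an ideal: `a ≡ b` iff `a ⊖ b` and `b ⊖ a` are both in `I`
(equivalently the distance `(a ⊖ b) ⊕ (b ⊖ a)` is in `I`). -/
def rel (I : MVIdeal A) (a b : A) : Prop := ominus a b ∈ I.carrier ∧ ominus b a ∈ I.carrier

theorem ominus_mem_iff (I : MVIdeal A) (a b : A) :
    ominus a b ∈ I.carrier ↔ ∃ i ∈ I.carrier, a ≤ b ⊕ₘ i :=
  ⟨fun h => ⟨_, h, (ominus_le_iff _ _ _).1 le_rfl⟩,
    fun ⟨_, hi, h⟩ => I.mem_of_le _ _ ((ominus_le_iff _ _ _).2 h) hi⟩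

theorem ominus_mem_trans (I : MVIdeal A) {a b c : A} (h₁ : ominus a b ∈ I.carrier)
    (h₂ : ominus b c ∈ I.carrier) : ominus a c ∈ I.carrier := by
  rw [ominus_mem_iff] at *
  obtain ⟨i, hi, h₁⟩ := h₁
  obtain ⟨j, hj, h₂⟩ := h₂
  refine ⟨j ⊕ₘ i, I.oplus_mem _ _ hj hi, h₁.trans ?_⟩
  rw [← oplus_assoc]
  exact oplus_le_oplus h₂ le_rfl

theorem ominus_oplus_mem (I : MVIdeal A) {a b c d : A} (h₁ : ominus a b ∈ I.carrier)
    (h₂ : ominus c d ∈ I.carrier) : ominus (a ⊕ₘ c) (b ⊕ₘ d) ∈ I.carrier := by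
  rw [ominus_mem_iff] at *
  obtain ⟨i, hi, h₁⟩ := h₁
  obtain ⟨j, hj, h₂⟩ := h₂
  refine ⟨i ⊕ₘ j, I.oplus_mem _ _ hi hj, (oplus_le_oplus h₁ h₂).trans (le_of_eq ?_)⟩
  rw [oplus_assoc, oplus_assoc, ← oplus_assoc i, oplus_comm i d, oplus_assoc d]

theorem ominus_neg_neg (a b : A) : ominus (neg a) (neg b) = ominus b a := by
  rw [ominus, ominus, MVAlgebra.neg_neg, oplus_comm]

theorem ominus_self_mem (I : MVIdeal A) (a : A) : ominus a a ∈ I.carrier :=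
  (I.ominus_mem_iff a a).2 ⟨zero, I.zero_mem, le_of_eq (oplus_zero a).symm⟩

/-- The congruence of an ideal, as a setoid. -/
def setoid (I : MVIdeal A) : Setoid A where
  r := I.rel
  iseqv :=
    { refl := fun a => ⟨I.ominus_self_mem a, I.ominus_self_mem a⟩
      symm := fun h => ⟨h.2, h.1⟩
      trans := fun h₁ h₂ => ⟨I.ominus_mem_trans h₁.1 h₂.1, I.ominus_mem_trans h₂.2 h₁.2⟩ }

/-- The quotient `A / I`. -/
def Quo (I : MVIdeal A) : Type u := Quotient I.setoid

/-- The class `a / I`. -/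
def proj (I : MVIdeal A) (a : A) : I.Quo := Quotient.mk I.setoid a

/-- The quotient MV-algebra `A / I`, with the operations induced from `A`. -/
instance (I : MVIdeal A) : MVAlgebra I.Quo :=
  MVAlgebra.ofAxioms
    (Quotient.map₂ (fun x y : A => x ⊕ₘ y) fun _ _ h₁ _ _ h₂ =>
      ⟨I.ominus_oplus_mem h₁.1 h₂.1, I.ominus_oplus_mem h₁.2 h₂.2⟩)
    (Quotient.map (fun x : A => neg x) fun a b h =>
      ⟨(ominus_neg_neg a b).symm ▸ h.2, (ominus_neg_neg b a).symm ▸ h.1⟩)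
    (I.proj zero)
    (by rintro ⟨x⟩ ⟨y⟩ ⟨z⟩; exact congrArg I.proj (oplus_assoc x y z))
    (by rintro ⟨x⟩ ⟨y⟩; exact congrArg I.proj (oplus_comm x y))
    (by rintro ⟨x⟩; exact congrArg I.proj (oplus_zero x))
    (by rintro ⟨x⟩; exact congrArg I.proj (MVAlgebra.neg_neg x))
    (by rintro ⟨x⟩; exact congrArg I.proj (oplus_one x))
    (by rintro ⟨x⟩ ⟨y⟩; exact congrArg I.proj (lukasiewicz x y))

end MVIdeal

/-- The maximal spectrum `Max A`. -/
def MaxSpec (A : Type u) [MVAlgebra A] : Type u := {M : MVIdeal A // M.IsMaximal}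

/-- The radical `Rad A`: the intersection of all maximal ideals of `A`. -/
def MVIdeal.radical (A : Type u) [MVAlgebra A] : MVIdeal A where
  carrier := {a | ∀ M : MVIdeal A, M.IsMaximal → a ∈ M.carrier}
  zero_mem M _ := M.zero_mem
  oplus_mem x y hx hy M hM := M.oplus_mem x y (hx M hM) (hy M hM)
  mem_of_le x y h hy M hM := M.mem_of_le x y h (hy M hM)

/-- `A` is simple if `{0}` is its only proper ideal. -/
def IsSimpleMV (A : Type u) [MVAlgebra A] : Prop :=
  ∀ I : MVIdeal A, I.IsProper ↔ I.carrier = {zero}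

/-- `A` is semisimple if it is a subdirect product of simple MV-algebras (the empty product is
allowed, so the one-element algebra is semisimple). -/
def IsSemisimpleMV (A : Type u) [MVAlgebra A] : Prop :=
  ∃ (X : Type u) (S : X → MVAlg.{u}) (f : MVHom A (∀ i, S i)),
    Function.Injective f ∧ ∀ i, IsSimpleMV (S i) ∧ Function.Surjective fun a => f a i

/-- The embedding `ι_M : A / M → [0, 1]`, for `M` a maximal ideal. For every maximal ideal exactly
one injective homomorphism `A / M → [0, 1]` exists, and this is the one selected. -/
noncomputable def maxEmbedding {A : Type u} [MVAlgebra A] (M : MaxSpec A) :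
    M.1.Quo → unitInterval :=
  haveI : Nonempty (M.1.Quo → unitInterval) := ⟨fun _ => 0⟩
  Classical.epsilon fun f : M.1.Quo → unitInterval =>
    Function.Injective f ∧ ∃ h : MVHom M.1.Quo unitInterval, h.toFun = f

/-- The fuzzy subset `â` of `Max A`, with `â M = ι_M (a / M)`. -/
noncomputable def hat {A : Type u} [MVAlgebra A] (a : A) : MaxSpec A → unitInterval :=
  fun M => maxEmbedding M (M.1.proj a)

/-- A cut of `A`: a subset equal to the set of lower bounds of its upper bounds. -/
def IsCut {A : Type u} [MVAlgebra A] (X : Set A) : Prop :=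
  X = lowerBounds (upperBounds X)

/-- A limit cut: a cut `X` such that the infimum, in `[0, 1]^(Max A)`, of the functions `b̂ ⊖ â`,
for `a` in `X` and `b` an upper bound of `X`, is the constant function `0`. -/
def IsLimitCut {A : Type u} [MVAlgebra A] (X : Set A) : Prop :=
  IsCut X ∧
    IsGLB {f : MaxSpec A → unitInterval |
      ∃ a ∈ X, ∃ b ∈ upperBounds X, f = ominus (hat b) (hat a)} zero

/-- `A` is limit cut complete: it is semisimple and each of its limit cuts has a supremum. -/
def IsLimitCutComplete (A : Type u) [MVAlgebra A] : Prop :=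
  IsSemisimpleMV A ∧ ∀ X : Set A, IsLimitCut X → ∃ s : A, IsLUB X s

/-- The limit cut completion `A^lcc`: the intersection of all the subalgebras of `[0, 1]^(Max A)`
which are limit cut complete and contain `â` for all `a` in `A`. -/
def lcCompletion (A : Type u) [MVAlgebra A] : MVSubalgebra (MaxSpec A → unitInterval) where
  carrier := {f | ∀ B : MVSubalgebra (MaxSpec A → unitInterval),
    IsLimitCutComplete B.carrier → (∀ a : A, hat a ∈ B.carrier) → f ∈ B.carrier}
  zero_mem B _ _ := B.zero_mem
  oplus_mem x y hx hy B h₁ h₂ := B.oplus_mem x y (hx B h₁ h₂) (hy B h₁ h₂)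
  neg_mem x hx B h₁ h₂ := B.neg_mem x (hx B h₁ h₂)

/-- The objects of the full subcategory of semisimple MV-algebras. -/
def MVss : ObjectProperty MVAlg.{u} := fun A => IsSemisimpleMV A

/-- The objects of the full subcategory of limit cut complete MV-algebras. -/
def MVlcc : ObjectProperty MVAlg.{u} := fun A => IsLimitCutComplete A

theorem MVlcc_le_MVss : MVlcc.{u} ≤ MVss.{u} := fun _ h => h.1

-- Everything rests on replacing `MaxSpec A` by the set of homomorphisms `A → [0,1]`. Hölder's
-- theorem (`MVAlgebra.exists_injective_hom`) embeds `A/M` in `[0,1]`, by reading binary digits off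
-- the operations; `MVHom.ext_of_ker` shows that a homomorphism to `[0,1]` is determined by its
-- kernel, which is maximal by `MVHom.ker_isMaximal`. So semisimple means that homomorphisms to
-- `[0,1]` separate points, and each of them kills `Rad A`; this gives the reflection `A/Rad A`.
--
-- For the completion, compactness turns the pointwise infimum condition on a limit cut into a
-- uniform one: for each ε, a single pair `a ∈ X`, `b ∈ uX` satisfies `g b - g a ≤ ε` for all `g`
-- (`IsLimitCut.exists_sub_le`). This condition passes through every homomorphism. Hence the image
-- of a limit cut under a map to a limit cut complete algebra is interpolated by an element
-- (`IsLimitCut.exists_between`), and every homomorphism to `[0,1]` takes only one possible value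
-- there (`IsLimitCut.eq_of_between`).
--
-- Since `A^lcc` is an intersection, its universal property follows by exhibiting limit cut complete
-- subalgebras of `[0,1]^(Max A)` that contain every `â`. The functions whose pullback along `Max C
-- → Max A` represents an element of `C` yield existence of extensions; the equalizer of two
-- extensions yields uniqueness.

universe w

/-! ### Arithmetic of MV-algebras: partial addition, lattice operations, multiples. -/

namespace MVAlgebra

section Arithmetic

variable {A : Type u} [MVAlgebra A] {x y z a b c : A}

theorem zero_oplus (x : A) : zero ⊕ₘ x = x := by rw [oplus_comm, oplus_zero]

theorem one_oplus (x : A) : neg zero ⊕ₘ x = neg zero := by rw [oplus_comm, oplus_one]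

theorem oplus_left_comm (x y z : A) : x ⊕ₘ (y ⊕ₘ z) = y ⊕ₘ (x ⊕ₘ z) := by
  rw [← oplus_assoc, oplus_comm x, oplus_assoc]

protected theorem zero_le (x : A) : zero ≤ x := by rw [le_iff, one_oplus]

protected theorem le_one (x : A) : x ≤ neg zero := by rw [le_iff, oplus_one]

theorem eq_zero_of_le (h : x ≤ zero) : x = zero := le_antisymm h (MVAlgebra.zero_le x)

theorem eq_one_of_le (h : neg zero ≤ x) : x = neg zero := le_antisymm (MVAlgebra.le_one x) h

theorem neg_anti (h : x ≤ y) : neg y ≤ neg x := by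
  rw [le_iff, neg_neg, oplus_comm]; exact (le_iff _ _).1 h

theorem neg_le_comm (h : neg x ≤ y) : neg y ≤ x := by
  simpa only [neg_neg] using neg_anti h

theorem le_neg_comm (h : x ≤ neg y) : y ≤ neg x := by
  simpa only [neg_neg] using neg_anti h

theorem neg_inj (h : neg x = neg y) : x = y := by
  rw [← neg_neg x, h, neg_neg]

theorem le_oplus_right (x y : A) : y ≤ x ⊕ₘ y := by
  simpa only [zero_oplus] using oplus_le_oplus (MVAlgebra.zero_le x) (le_refl y)

theorem le_oplus_left (x y : A) : x ≤ x ⊕ₘ y := oplus_comm x y ▸ le_oplus_right y x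

theorem ominus_le (x y : A) : ominus x y ≤ x := (ominus_le_iff _ _ _).2 (le_oplus_right _ _)

theorem ominus_mono (h : x ≤ y) (z : A) : ominus x z ≤ ominus y z :=
  neg_anti (oplus_le_oplus (neg_anti h) le_rfl)

theorem ominus_anti (z : A) (h : x ≤ y) : ominus z y ≤ ominus z x :=
  neg_anti (oplus_le_oplus le_rfl h)

theorem ominus_eq_zero_iff : ominus x y = zero ↔ x ≤ y := by
  rw [le_iff, ominus]
  exact ⟨fun h => by rw [← h, neg_neg], fun h => by rw [h, neg_neg]⟩

theorem ominus_oplus_cancel_of_le (h : x ≤ y) : ominus y x ⊕ₘ x = y := by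
  have h1 := lukasiewicz y x
  rwa [(le_iff x y).1 h, neg_neg, zero_oplus] at h1

/-- The difference `y ⊖ x` is orthogonal to `x`. -/
theorem ominus_le_neg (y x : A) : ominus y x ≤ neg x := neg_anti (le_oplus_right _ _)

/-- The condition `x ≤ neg y` says that `x + y` is not truncated. On such orthogonal pairs `⊕`
behaves like addition in an ordered group: it cancels, and the next lemmas give associativity of
orthogonality. -/
theorem oplus_ominus_cancel (h : x ≤ neg y) : ominus (x ⊕ₘ y) y = x := by
  have h1 := lukasiewicz (neg x) y
  rw [neg_neg, oplus_comm (neg y), (le_iff _ _).1 h, neg_neg, zero_oplus] at h1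
  rw [ominus, h1, neg_neg]

theorem oplus_left_cancel (hy : x ≤ neg y) (hz : x ≤ neg z) (h : x ⊕ₘ y = x ⊕ₘ z) : y = z := by
  rw [← oplus_ominus_cancel (le_neg_comm hy), ← oplus_ominus_cancel (le_neg_comm hz),
    oplus_comm y, oplus_comm z, h]

theorem orth_assoc (h₁ : x ≤ neg y) (h₂ : x ⊕ₘ y ≤ neg z) : x ≤ neg (y ⊕ₘ z) := by
  have h := ominus_mono h₂ y
  rwa [oplus_ominus_cancel h₁, ominus, neg_neg, oplus_comm z] at h

theorem orth_assoc_symm (h₁ : y ≤ neg z) (h₂ : x ≤ neg (y ⊕ₘ z)) : x ⊕ₘ y ≤ neg z := by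
  have h₃ : z ⊕ₘ y ≤ neg x := by rw [oplus_comm]; exact le_neg_comm h₂
  have := orth_assoc (le_neg_comm h₁) h₃
  rw [oplus_comm]
  exact le_neg_comm this

/-- The complement of an orthogonal sum. -/
theorem neg_oplus_cancel (h : x ≤ neg y) : neg (x ⊕ₘ y) ⊕ₘ x = neg y := by
  have := ominus_oplus_cancel_of_le h
  rwa [ominus, neg_neg, oplus_comm y] at this

theorem neg_oplus_orth (x y : A) : neg (x ⊕ₘ y) ≤ neg x := neg_anti (le_oplus_left x y)

/-- The join of two elements. -/
def join (x y : A) : A := ominus x y ⊕ₘ y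

theorem le_join_left (x y : A) : x ≤ join x y := by
  rw [join, oplus_comm]; exact (ominus_le_iff _ _ _).1 le_rfl

theorem le_join_right (x y : A) : y ≤ join x y := le_oplus_right _ _

theorem join_le (hx : x ≤ z) (hy : y ≤ z) : join x y ≤ z :=
  (oplus_le_oplus (ominus_mono hx y) le_rfl).trans (ominus_oplus_cancel_of_le hy).le

/-- The meet of two elements. -/
def meet (x y : A) : A := neg (join (neg x) (neg y))

theorem meet_le_left (x y : A) : meet x y ≤ x := neg_le_comm (le_join_left _ _)

theorem meet_le_right (x y : A) : meet x y ≤ y := neg_le_comm (le_join_right _ _)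

theorem le_meet (hx : z ≤ x) (hy : z ≤ y) : z ≤ meet x y :=
  le_neg_comm (join_le (neg_anti hx) (neg_anti hy))

theorem ominus_ominus_comm (x y : A) : ominus x (ominus x y) = ominus y (ominus y x) := by
  apply neg_inj
  have := lukasiewicz (neg x) (neg y)
  simp only [ominus, neg_neg] at *
  rw [oplus_comm (neg x) (neg _), oplus_comm (neg y) (neg _)]
  rw [oplus_comm x, oplus_comm y] at this
  exact this.symm

theorem ominus_zero (x : A) : ominus x zero = x := by rw [ominus, oplus_zero, neg_neg]

theorem ominus_ominus_cancel (h : y ≤ x) : ominus x (ominus x y) = y := by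
  rw [ominus_ominus_comm, ominus_eq_zero_iff.2 h, ominus_zero]

/-- The two differences `x ⊖ y` and `y ⊖ x` are disjoint. -/
theorem eq_zero_of_le_ominus (h₁ : c ≤ ominus x y) (h₂ : c ≤ ominus y x) : c = zero := by
  have hm := ominus_ominus_comm x y
  set m := ominus x (ominus x y) with hmd
  -- Here `m` is the meet of `x` and `y`, written in its two symmetric forms. Adding `c` to `m`
  -- stays below both `x` and `y`, hence below `m`; since `c` is orthogonal to `m`, it cancels to
  -- zero.
  have hc : c ≤ neg m := h₁.trans (le_neg_comm (ominus_le_neg _ _))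
  have hx : m ⊕ₘ c ≤ x := (oplus_le_oplus le_rfl h₁).trans_eq
    (ominus_oplus_cancel_of_le (ominus_le x y))
  have hy : m ⊕ₘ c ≤ y := (oplus_le_oplus le_rfl h₂).trans_eq
    (by rw [hm]; exact ominus_oplus_cancel_of_le (ominus_le y x))
  have h3 : m ⊕ₘ c ≤ m := (ominus_ominus_cancel hx).symm.trans_le
    (ominus_anti x (ominus_anti x hy))
  have := ominus_mono h3 m
  rw [oplus_comm m, oplus_ominus_cancel hc, ominus_eq_zero_iff.2 (le_refl m)] at this
  exact eq_zero_of_le this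

/-- The multiple `x ⊕ ⋯ ⊕ x`. -/
def nmul (n : ℕ) (x : A) : A := (fun y => x ⊕ₘ y)^[n] zero

theorem nmul_zero (x : A) : nmul 0 x = zero := rfl

theorem nmul_succ (n : ℕ) (x : A) : nmul (n + 1) x = x ⊕ₘ nmul n x :=
  Function.iterate_succ_apply' _ _ _

theorem nmul_one (x : A) : nmul 1 x = x := by rw [nmul_succ, nmul_zero, oplus_zero]

theorem nmul_add (m n : ℕ) (x : A) : nmul (m + n) x = nmul m x ⊕ₘ nmul n x := by
  induction m with
  | zero => rw [Nat.zero_add, nmul_zero, zero_oplus]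
  | succ m ih => rw [Nat.succ_add, nmul_succ, ih, nmul_succ, oplus_assoc]

theorem nmul_mono (n : ℕ) (h : x ≤ y) : nmul n x ≤ nmul n y := by
  induction n with
  | zero => exact le_rfl
  | succ n ih => rw [nmul_succ, nmul_succ]; exact oplus_le_oplus h ih

/-- If `a` and `b` are disjoint, so are `b` and any multiple of `a`. -/
theorem disjoint_nmul (h : ∀ c : A, c ≤ a → c ≤ b → c = zero) (n : ℕ) :
    ∀ c : A, c ≤ nmul n a → c ≤ b → c = zero := by
  induction n with
  | zero => exact fun c hc _ => eq_zero_of_le hc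
  | succ n ih =>
    intro c hc hb
    rw [nmul_succ] at hc
    have := ih (ominus c a) ((ominus_le_iff _ _ _).2 hc) ((ominus_le c a).trans hb)
    exact h c (ominus_eq_zero_iff.1 this) hb

end Arithmetic

/-- An MV-algebra in which every nonzero element has a multiple equal to `1` is a chain. -/
theorem le_total_of_nmul {A : Type u} [MVAlgebra A]
    (h : ∀ q : A, q ≠ zero → ∃ n, nmul n q = neg zero) (x y : A) : x ≤ y ∨ y ≤ x := by
  by_cases hq : ominus x y = zero
  · exact Or.inl (ominus_eq_zero_iff.1 hq)
  · obtain ⟨n, hn⟩ := h _ hq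
    -- The multiple of `x ⊖ y` that equals `1` is still disjoint from `y ⊖ x`, so `y ⊖ x` vanishes.
    refine Or.inr (ominus_eq_zero_iff.1 (disjoint_nmul (a := ominus x y)
      (fun c hc hb => eq_zero_of_le_ominus hc hb) n _ ?_ le_rfl))
    rw [hn]; exact MVAlgebra.le_one _

end MVAlgebra

/-! ### Doubling and binary expansions. -/

namespace MVAlgebra

section Halving

variable {A : Type u} [MVAlgebra A] {x y : A}

instance : Std.Associative (α := A) oplus := ⟨oplus_assoc⟩

instance : Std.Commutative (α := A) oplus := ⟨oplus_comm⟩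

/-- The square `x ⊙ x`. -/
def square (x : A) : A := neg (neg x ⊕ₘ neg x)

theorem square_neg (x : A) : square (neg x) = neg (x ⊕ₘ x) := by rw [square, neg_neg]

theorem square_oplus_neg (h : neg x ≤ x) : square x ⊕ₘ neg x = x :=
  ominus_oplus_cancel_of_le h

theorem square_orth (x : A) : square x ≤ neg (neg x) := ominus_le_neg x (neg x)

/-- This and the next two lemmas are the cases of binary addition of orthogonal `x` and `y`: the sum
is at most one half; both summands are at most one half but the sum is at least one half; one
summand is already at least one half. -/
theorem double_orth_double (h : x ≤ neg y) (hs : x ⊕ₘ y ≤ neg (x ⊕ₘ y)) :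
    x ⊕ₘ x ≤ neg (y ⊕ₘ y) := by
  have h1 : x ≤ neg (x ⊕ₘ (y ⊕ₘ y)) := by
    have := orth_assoc h hs
    rwa [oplus_left_comm] at this
  exact orth_assoc_symm (h1.trans (neg_anti (le_oplus_right _ _))) h1

/-- The carry: `2(x + y) - 1 = 2y - (1 - 2x)`. With `t = y - x`, one has `2y = (x + y) + t` and `1 -
2x = (1 - (x + y)) + t`, and the identity follows by cancelling first `t`, then `1 - (x + y)`. -/
theorem square_oplus_of_le (hxy : x ≤ y) (h : x ≤ neg y) (hy : y ≤ neg y)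
    (hs : neg (x ⊕ₘ y) ≤ x ⊕ₘ y) :
    neg (x ⊕ₘ x) ≤ y ⊕ₘ y ∧ square (x ⊕ₘ y) = ominus (y ⊕ₘ y) (neg (x ⊕ₘ x)) := by
  set t := ominus y x
  have hty : t ⊕ₘ x = y := ominus_oplus_cancel_of_le hxy
  have ht : t ≤ neg (x ⊕ₘ x) := orth_assoc ((ominus_le_neg y x)) (by rw [hty]; exact le_neg_comm h)
  have e1 : neg (x ⊕ₘ y) ⊕ₘ t = neg (x ⊕ₘ x) := by
    rw [← neg_oplus_cancel ht]
    congr 2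
    rw [← hty]; ac_rfl
  have e2 : y ⊕ₘ y = (x ⊕ₘ y) ⊕ₘ t := by
    rw [show (x ⊕ₘ y) ⊕ₘ t = (t ⊕ₘ x) ⊕ₘ y by ac_rfl, hty]
  have hle : neg (x ⊕ₘ x) ≤ y ⊕ₘ y := by
    rw [← e1, e2]; exact oplus_le_oplus hs le_rfl
  refine ⟨hle, ?_⟩
  set v := ominus (y ⊕ₘ y) (neg (x ⊕ₘ x))
  have hv : v ⊕ₘ neg (x ⊕ₘ x) = y ⊕ₘ y := ominus_oplus_cancel_of_le hle
  have hts : t ≤ neg (x ⊕ₘ y) := orth_assoc (ominus_le_neg y x) (by rw [hty]; exact hy)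
  have htns : neg (x ⊕ₘ y) ≤ neg t :=
    neg_anti ((ominus_le y x).trans (le_oplus_right _ _))
  have hv2 : v ⊕ₘ neg (x ⊕ₘ y) ≤ neg t := orth_assoc_symm htns (by
    rw [e1]; exact ominus_le_neg _ _)
  have e3 : x ⊕ₘ y = v ⊕ₘ neg (x ⊕ₘ y) := by
    refine oplus_left_cancel (x := t) hts (le_neg_comm hv2) ?_
    rw [oplus_comm t, ← e2, ← hv, ← e1]; ac_rfl
  refine oplus_left_cancel (x := neg (x ⊕ₘ y)) (le_neg_comm (square_orth _))
    (le_neg_comm ?_) ?_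
  · exact (ominus_le_neg _ _).trans (neg_anti (by rw [← e1]; exact le_oplus_left _ _))
  · rw [oplus_comm _ (square _), square_oplus_neg hs, oplus_comm _ v]; exact e3

theorem square_oplus_of_ge (h : x ≤ neg y) (hx : neg x ≤ x) :
    square x ≤ neg (y ⊕ₘ y) ∧ neg (x ⊕ₘ y) ≤ x ⊕ₘ y ∧
      square (x ⊕ₘ y) = square x ⊕ₘ (y ⊕ₘ y) := by
  have hyx : y ≤ neg x := le_neg_comm h
  have hs : neg (x ⊕ₘ y) ≤ x ⊕ₘ y :=
    ((neg_oplus_orth x y).trans hx).trans (le_oplus_left _ _)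
  refine ⟨neg_anti (oplus_le_oplus hyx hyx), hs, ?_⟩
  have e1 : y ⊕ₘ neg (x ⊕ₘ y) = neg x := by
    rw [oplus_comm, oplus_comm x]; exact neg_oplus_cancel hyx
  have hy : y ⊕ₘ y ≤ neg (neg (x ⊕ₘ y)) := by
    refine orth_assoc_symm ?_ ?_
    · rw [neg_neg]; exact le_oplus_right _ _
    · rw [e1, neg_neg]; exact hyx.trans hx
  have e2 : y ⊕ₘ y ⊕ₘ neg (x ⊕ₘ y) = neg x ⊕ₘ y := by rw [oplus_assoc, e1, oplus_comm]
  have ho : square x ⊕ₘ (y ⊕ₘ y) ≤ neg (neg (x ⊕ₘ y)) := by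
    refine orth_assoc_symm hy ?_
    rw [e2]
    exact orth_assoc (square_orth x) (by rwa [square_oplus_neg hx])
  refine oplus_left_cancel (x := neg (x ⊕ₘ y)) (le_neg_comm (square_orth _))
    (le_neg_comm ho) ?_
  rw [oplus_comm _ (square (x ⊕ₘ y)), square_oplus_neg hs, oplus_comm (neg (x ⊕ₘ y)),
    oplus_assoc, e2, ← oplus_assoc,
    square_oplus_neg hx]

open scoped Classical in
/-- The first binary digit of an element of an MV-algebra. -/
noncomputable def digit (x : A) : ℝ := if x ≤ neg x then 0 else 1

open scoped Classical in
/-- The shift of the binary expansion of an element of an MV-algebra. -/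
noncomputable def shift (x : A) : A := if x ≤ neg x then x ⊕ₘ x else square x

/-- The real number with the binary digits of an element of an MV-algebra. -/
noncomputable def value (x : A) : ℝ := ∑' n : ℕ, digit (shift^[n] x) / 2 / 2 ^ n

theorem digit_nonneg (x : A) : 0 ≤ digit x := by unfold digit; split_ifs <;> norm_num

theorem digit_le_one (x : A) : digit x ≤ 1 := by unfold digit; split_ifs <;> norm_num

theorem summable_digit (x : A) : Summable fun n : ℕ => digit (shift^[n] x) / 2 / 2 ^ n := by
  refine Summable.of_nonneg_of_le (fun n => ?_) (fun n => ?_) (summable_geometric_two' 1)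
  · have := digit_nonneg (shift^[n] x); positivity
  · have := digit_le_one (shift^[n] x); gcongr

theorem value_nonneg (x : A) : 0 ≤ value x :=
  tsum_nonneg fun n => by have := digit_nonneg (shift^[n] x); positivity

theorem value_le_one (x : A) : value x ≤ 1 := by
  rw [← tsum_geometric_two' 1]
  refine (summable_digit x).tsum_le_tsum (fun n => ?_) (summable_geometric_two' 1)
  have := digit_le_one (shift^[n] x); gcongr

theorem value_eq (x : A) : value x = digit x / 2 + value (shift x) / 2 := by
  rw [value, (summable_digit x).tsum_eq_zero_add, value, ← tsum_div_const]
  simp only [Function.iterate_zero, id, pow_zero, div_one, Function.iterate_succ_apply]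
  congr 2
  ext n
  rw [pow_succ]; ring

theorem value_of_le (h : x ≤ neg x) : value x = value (x ⊕ₘ x) / 2 := by
  rw [value_eq, digit, shift, if_pos h, if_pos h]; ring

theorem value_zero : value (zero : A) = 0 := by
  have := value_of_le (MVAlgebra.zero_le (neg (zero : A)))
  rw [oplus_zero] at this; linarith

theorem value_one (h0 : (zero : A) ≠ neg zero) : value (neg (zero : A)) = 1 := by
  have h : ¬ neg (zero : A) ≤ neg (neg zero) := fun h => h0 (by
    rw [neg_neg] at h; exact (eq_zero_of_le h).symm)
  have := value_eq (neg (zero : A))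
  rw [digit, shift, if_neg h, if_neg h, square_neg, oplus_zero] at this
  linarith

/-- At a fixed point `x = neg x` the digit is `0`, but the expansion is then `0.0111…`, so the
formula for digit `1` remains valid there. -/
theorem value_of_ge (h0 : (zero : A) ≠ neg zero) (h : neg x ≤ x) :
    value x = 1 / 2 + value (square x) / 2 := by
  by_cases hx : x ≤ neg x
  · have e : neg x = x := le_antisymm h hx
    have e1 : x ⊕ₘ x = neg zero := by have := (le_iff _ _).1 h; rwa [neg_neg] at this
    rw [value_of_le hx, square, e, e1, neg_neg, value_one h0, value_zero]; ring
  · rw [value_eq, digit, shift, if_neg hx, if_neg hx]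

end Halving

/-! ### Additivity of the binary value on a chain. -/

section Chain

variable {A : Type u} [MVAlgebra A]

theorem eq_zero_of_forall_le_half_pow {r c : ℝ} (h : ∀ n : ℕ, |r| ≤ c * (1 / 2) ^ n) : r = 0 := by
  have h1 : Filter.Tendsto (fun n : ℕ => c * (1 / 2 : ℝ) ^ n) Filter.atTop (nhds (c * 0)) :=
    (tendsto_pow_atTop_nhds_zero_of_lt_one (by norm_num) (by norm_num)).const_mul c
  rw [mul_zero] at h1
  exact abs_nonpos_iff.1 (ge_of_tendsto' h1 h)

/-- Doubling `x` while squaring `neg x` doubles the defect of the identity. A defect bounded by `1`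
that can be doubled indefinitely is zero. -/
theorem value_neg (h0 : (zero : A) ≠ neg zero) (ht : ∀ x y : A, x ≤ y ∨ y ≤ x) (x : A) :
    value (neg x) = 1 - value x := by
  suffices h : ∀ (n : ℕ) (x : A), x ≤ neg x →
      |value x + value (neg x) - 1| ≤ 1 * (1 / 2) ^ n by
    rcases ht x (neg x) with hx | hx
    · linarith [eq_zero_of_forall_le_half_pow fun n => h n x hx]
    · have := eq_zero_of_forall_le_half_pow fun n => h n (neg x) (by rwa [neg_neg])
      rw [neg_neg] at this; linarith
  intro n
  induction n with
  | zero =>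
    intro x _
    rw [abs_le]
    constructor <;> linarith [value_nonneg x, value_nonneg (neg x), value_le_one x,
      value_le_one (neg x)]
  | succ n ih =>
    intro x hx
    rw [value_of_le hx, value_of_ge h0 (x := neg x) (by rwa [neg_neg]), square_neg]
    have key : |value (x ⊕ₘ x) + value (neg (x ⊕ₘ x)) - 1| ≤ 1 * (1 / 2) ^ n := by
      rcases ht (x ⊕ₘ x) (neg (x ⊕ₘ x)) with h | h
      · exact ih _ h
      · have := ih (neg (x ⊕ₘ x)) (by rwa [neg_neg])
        rwa [neg_neg, add_comm (value _)] at this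
    rw [abs_le] at key ⊢
    rw [pow_succ]
    constructor <;> linarith [key.1, key.2]

/-- Again the defect, at most `2` a priori, doubles with each shift of digits. In the carry case the
induction hypothesis is applied to the orthogonal pair `2y ⊖ neg (2x)`, `neg (2x)`, whose sum is
`2y`. -/
theorem value_oplus (h0 : (zero : A) ≠ neg zero) (ht : ∀ x y : A, x ≤ y ∨ y ≤ x) {x y : A}
    (hxy : x ≤ neg y) : value (x ⊕ₘ y) = value x + value y := by
  suffices h : ∀ (n : ℕ) (x y : A), x ≤ neg y →
      |value (x ⊕ₘ y) - value x - value y| ≤ 2 * (1 / 2) ^ n by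
    linarith [eq_zero_of_forall_le_half_pow fun n => h n x y hxy]
  clear hxy x y
  intro n
  induction n with
  | zero =>
    intro x y _
    rw [abs_le]
    constructor <;> linarith [value_nonneg x, value_nonneg y, value_le_one x,
      value_le_one y, value_nonneg (x ⊕ₘ y), value_le_one (x ⊕ₘ y)]
  | succ n ih =>
    suffices key : ∀ x y : A, x ≤ y → x ≤ neg y →
        |value (x ⊕ₘ y) - value x - value y| ≤ 2 * (1 / 2) ^ (n + 1) by
      intro x y h
      rcases ht x y with hxy | hxy
      · exact key x y hxy h
      · have := key y x hxy (le_neg_comm h)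
        rwa [oplus_comm, sub_right_comm] at this
    intro x y hle h
    have hx : x ≤ neg x := h.trans (neg_anti hle)
    rw [pow_succ]
    rcases ht y (neg y) with hy | hy
    · rcases ht (x ⊕ₘ y) (neg (x ⊕ₘ y)) with hs | hs
      · have := ih _ _ (double_orth_double h hs)
        rw [value_of_le hx, value_of_le hy, value_of_le hs,
          show (x ⊕ₘ y) ⊕ₘ (x ⊕ₘ y) = (x ⊕ₘ x) ⊕ₘ (y ⊕ₘ y) by ac_rfl]
        rw [abs_le] at this ⊢
        constructor <;> linarith [this.1, this.2]
      · obtain ⟨h1, h2⟩ := square_oplus_of_le hle h hy hs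
        have := ih _ _ (ominus_le_neg (y ⊕ₘ y) (neg (x ⊕ₘ x)))
        rw [ominus_oplus_cancel_of_le h1, value_neg h0 ht] at this
        rw [value_of_le hx, value_of_le hy, value_of_ge h0 hs, h2]
        rw [abs_le] at this ⊢
        constructor <;> linarith [this.1, this.2]
    · obtain ⟨h1, h2, h3⟩ := square_oplus_of_ge (le_neg_comm h) hy
      have := ih _ _ h1
      rw [oplus_comm x, value_of_le hx, value_of_ge h0 hy, value_of_ge h0 h2, h3]
      rw [abs_le] at this ⊢
      constructor <;> linarith [this.1, this.2]

theorem coe_oplus (x y : unitInterval) : ((x ⊕ₘ y : unitInterval) : ℝ) = min 1 ((x : ℝ) + y) := rfl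

theorem coe_neg (x : unitInterval) : ((neg x : unitInterval) : ℝ) = 1 - x := rfl

theorem coe_zero : ((zero : unitInterval) : ℝ) = 0 := rfl

theorem coe_ominus (x y : unitInterval) :
    ((ominus x y : unitInterval) : ℝ) = max 0 ((x : ℝ) - y) := by
  rw [ominus, coe_neg, coe_oplus, coe_neg]
  grind

end Chain

end MVAlgebra

/-! ### Homomorphisms to the unit interval: existence and uniqueness. -/

namespace MVHom

variable {A : Type u} {B : Type v} [MVAlgebra A] [MVAlgebra B] (g : MVHom A B)

theorem map_ominus (x y : A) : g (ominus x y) = ominus (g x) (g y) := by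
  simp only [ominus, g.map_neg, g.map_oplus]

theorem mono {x y : A} (h : x ≤ y) : g x ≤ g y := by
  rw [le_iff, ← g.map_neg, ← g.map_oplus, (le_iff _ _).1 h, g.map_neg, g.map_zero]

theorem map_nmul (n : ℕ) (x : A) : g (nmul n x) = nmul n (g x) := by
  induction n with
  | zero => exact g.map_zero
  | succ n ih => rw [nmul_succ, nmul_succ, g.map_oplus, ih]

end MVHom

/-- **Hölder's theorem** for MV-algebras: if every nonzero element has a multiple equal to `1`, then
there is an embedding into the unit interval. -/
theorem MVAlgebra.exists_injective_hom {A : Type u} [MVAlgebra A] (h0 : (zero : A) ≠ neg zero)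
    (h : ∀ q : A, q ≠ zero → ∃ n, nmul n q = neg zero) :
    ∃ g : MVHom A unitInterval, Function.Injective g := by
  have ht := le_total_of_nmul h
  have hmono : ∀ x y : A, x ≤ y → value x ≤ value y := fun x y hxy => by
    rw [← ominus_oplus_cancel_of_le hxy, value_oplus h0 ht (ominus_le_neg y x)]
    linarith [value_nonneg (ominus y x)]
  refine ⟨⟨fun x => ⟨value x, value_nonneg x, value_le_one x⟩, Subtype.ext value_zero,
    fun x y => Subtype.ext ?_, fun x => Subtype.ext (value_neg h0 ht x)⟩, fun x y hxy => ?_⟩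
  · change value (x ⊕ₘ y) = min 1 (value x + value y)
    rcases ht x (neg y) with hxy | hxy
    · rw [← value_oplus h0 ht hxy, min_eq_right (value_le_one _)]
    · have h1 := hmono _ _ hxy
      rw [value_neg h0 ht] at h1
      have h2 := (le_iff _ _).1 hxy
      rw [neg_neg, oplus_comm] at h2
      rw [h2, value_one h0, min_eq_left (by linarith)]
  -- Injectivity reduces to a trivial kernel: if `value q = 0`, additivity makes every multiple of
  -- `q` have value `0`, whereas some multiple is `1`, of value `1`.
  · have hz : ∀ q : A, value q = 0 → q = zero := by
      intro q hq
      by_contra hne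
      obtain ⟨n, hn⟩ := h q hne
      have : ∀ n, value (nmul n q) ≤ 0 := by
        intro n
        induction n with
        | zero => rw [nmul_zero, value_zero]
        | succ n ih =>
          rw [nmul_succ]
          rcases ht q (neg (nmul n q)) with hxy | hxy
          · rw [value_oplus h0 ht hxy, hq]; linarith
          · have := hmono _ _ hxy
            rw [value_neg h0 ht] at this
            linarith
      have := this n
      rw [hn, value_one h0] at this
      linarith
    have hv : value x = value y := congrArg Subtype.val hxy
    have hd : ∀ x y : A, value x = value y → x ≤ y := by
      intro x y hv
      rcases ht x y with hle | hle
      · exact hle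
      · have := value_oplus h0 ht (ominus_le_neg x y)
        rw [ominus_oplus_cancel_of_le hle] at this
        exact ominus_eq_zero_iff.1 (hz _ (by linarith))
    exact le_antisymm (hd _ _ hv) (hd _ _ hv.symm)

namespace MVHom

/-- The composite of two homomorphisms. -/
def comp {A : Type u} {B : Type v} {C : Type w} [MVAlgebra A] [MVAlgebra B] [MVAlgebra C]
    (g : MVHom B C) (f : MVHom A B) : MVHom A C where
  toFun a := g (f a)
  map_zero := by rw [f.map_zero, g.map_zero]
  map_oplus x y := by rw [f.map_oplus, g.map_oplus]
  map_neg x := by rw [f.map_neg, g.map_neg]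

/-- Evaluation at a point, for a product of MV-algebras. -/
def eval {X : Type v} (S : X → Type u) [∀ i, MVAlgebra (S i)] (i : X) :
    MVHom (∀ i, S i) (S i) := ⟨fun f => f i, rfl, fun _ _ => rfl, fun _ => rfl⟩

/-- A homomorphism into a product, given by its components. -/
def pi {A : Type w} [MVAlgebra A] {X : Type v} {S : X → Type u} [∀ i, MVAlgebra (S i)]
    (f : ∀ i, MVHom A (S i)) : MVHom A (∀ i, S i) where
  toFun a i := f i a
  map_zero := funext fun i => (f i).map_zero
  map_oplus x y := funext fun i => (f i).map_oplus x y
  map_neg x := funext fun i => (f i).map_neg x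

/-- The kernel of a homomorphism. -/
def ker {A : Type u} {B : Type v} [MVAlgebra A] [MVAlgebra B] (g : MVHom A B) : MVIdeal A where
  carrier := {a | g a = zero}
  zero_mem := g.map_zero
  oplus_mem x y hx hy := by
    simp only [Set.mem_ofPred_eq] at *
    rw [g.map_oplus, hx, hy, oplus_zero]
  mem_of_le x y h hy := eq_zero_of_le ((g.mono h).trans_eq hy)

/-- Two homomorphisms to the unit interval whose kernels are comparable are equal. -/
theorem ext_of_ker {A : Type u} [MVAlgebra A] {g h : MVHom A unitInterval}
    (hk : ∀ a, g a = zero → h a = zero) : g = h := by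
  -- The excess `h x - g x` doubles under `x ⊕ x` or `x ⊙ x`, according to the side of `1/2` on
  -- which both values lie. If `1/2` separates them, `x ⊙ x` is killed by `g` but not by `h`,
  -- against `hk`.
  have key : ∀ (n : ℕ) (x : A), (h x : ℝ) - g x ≤ 1 * (1 / 2) ^ n := by
    intro n
    induction n with
    | zero => intro x; have := (h x).2.2; have := (g x).2.1; norm_num; linarith
    | succ n ih =>
      intro x
      have h1 := ih (x ⊕ₘ x)
      have h2 := ih (square x)
      have h3 : (h (square x) : ℝ) = max 0 (2 * (h x : ℝ) - 1) := by
        rw [square, h.map_neg, h.map_oplus, h.map_neg, MVAlgebra.coe_neg, coe_oplus,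
          MVAlgebra.coe_neg]
        grind
      have h4 : (g (square x) : ℝ) = max 0 (2 * (g x : ℝ) - 1) := by
        rw [square, g.map_neg, g.map_oplus, g.map_neg, MVAlgebra.coe_neg, coe_oplus,
          MVAlgebra.coe_neg]
        grind
      rw [h.map_oplus, g.map_oplus, coe_oplus, coe_oplus] at h1
      have hp : (0 : ℝ) < (1 / 2) ^ n := by positivity
      rw [pow_succ]
      rcases le_or_gt (h x : ℝ) (g x) with hle | hlt
      · linarith
      rcases le_or_gt (h x : ℝ) (1 / 2) with hh | hh
      · rw [min_eq_right (by linarith), min_eq_right (by linarith)] at h1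
        linarith
      rcases le_or_gt (g x : ℝ) (1 / 2) with hg | hg
      · have h5 : g (square x) = zero := Subtype.ext (by
          rw [h4, coe_zero, max_eq_left (by linarith)])
        have h6 := hk _ h5
        rw [h6, coe_zero] at h3
        have := le_max_right (0 : ℝ) (2 * (h x : ℝ) - 1)
        linarith
      · rw [h3, h4, max_eq_right (by linarith), max_eq_right (by linarith)] at h2
        linarith
  have hle : ∀ x, (h x : ℝ) ≤ g x := by
    intro x
    have h1 : Filter.Tendsto (fun n : ℕ => 1 * (1 / 2 : ℝ) ^ n) Filter.atTop (nhds (1 * 0)) :=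
      (tendsto_pow_atTop_nhds_zero_of_lt_one (by norm_num) (by norm_num)).const_mul 1
    have := ge_of_tendsto' h1 fun n => key n x
    linarith
  ext x
  -- The inequality at `neg x` is the reverse inequality at `x`.
  have h1 := hle (neg x)
  rw [h.map_neg, g.map_neg, MVAlgebra.coe_neg, MVAlgebra.coe_neg] at h1
  linarith [hle x]

end MVHom

theorem MVAlgebra.coe_nmul (n : ℕ) (x : unitInterval) :
    ((nmul n x : unitInterval) : ℝ) = min 1 (n * (x : ℝ)) := by
  induction n with
  | zero => simp [nmul_zero, coe_zero]
  | succ n ih =>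
    rw [nmul_succ, coe_oplus, ih]
    have := x.2.1
    push_cast
    grind

/-! ### Ideals, quotients and maximal ideals. -/

namespace MVIdeal

variable {A : Type u} [MVAlgebra A]

theorem nmul_mem (I : MVIdeal A) {x : A} (hx : x ∈ I.carrier) (n : ℕ) : nmul n x ∈ I.carrier := by
  induction n with
  | zero => exact I.zero_mem
  | succ n ih => rw [nmul_succ]; exact I.oplus_mem _ _ hx ih

theorem isProper_iff (I : MVIdeal A) : I.IsProper ↔ neg zero ∉ I.carrier := by
  rw [IsProper, not_iff_not, Set.eq_univ_iff_forall]
  exact ⟨fun h => h _, fun h x => I.mem_of_le _ _ (MVAlgebra.le_one x) h⟩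

/-- The canonical projection onto a quotient. -/
def projHom (I : MVIdeal A) : MVHom A I.Quo :=
  ⟨I.proj, rfl, fun _ _ => rfl, fun _ => rfl⟩

theorem proj_surjective (I : MVIdeal A) : Function.Surjective I.proj := Quotient.mk_surjective

theorem proj_eq_iff (I : MVIdeal A) {a b : A} : I.proj a = I.proj b ↔ I.rel a b :=
  ⟨fun h => Quotient.exact h, fun h => Quotient.sound h⟩

theorem ominus_zero_left (a : A) : ominus zero a = zero :=
  ominus_eq_zero_iff.2 (MVAlgebra.zero_le a)

theorem proj_eq_zero_iff (I : MVIdeal A) {a : A} : I.proj a = zero ↔ a ∈ I.carrier := by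
  refine I.proj_eq_iff.trans ?_
  rw [rel, ominus_zero, ominus_zero_left]
  exact and_iff_left I.zero_mem

/-- The homomorphism out of a quotient induced by a homomorphism vanishing on the ideal. -/
def lift {B : Type v} [MVAlgebra B] (I : MVIdeal A) (g : MVHom A B)
    (h : ∀ a ∈ I.carrier, g a = zero) : MVHom I.Quo B where
  toFun := Quotient.lift g.toFun fun a b hab => le_antisymm
    (ominus_eq_zero_iff.1 (by rw [← g.map_ominus, h _ hab.1]))
    (ominus_eq_zero_iff.1 (by rw [← g.map_ominus, h _ hab.2]))
  map_zero := g.map_zero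
  map_oplus := by rintro ⟨x⟩ ⟨y⟩; exact g.map_oplus x y
  map_neg := by rintro ⟨x⟩; exact g.map_neg x

/-- The ideal generated by an ideal and an element. -/
def adjoin (I : MVIdeal A) (x : A) : MVIdeal A where
  carrier := {y | ∃ m ∈ I.carrier, ∃ n, y ≤ m ⊕ₘ nmul n x}
  zero_mem := ⟨zero, I.zero_mem, 0, MVAlgebra.zero_le _⟩
  oplus_mem := by
    rintro y z ⟨m, hm, n, h⟩ ⟨m', hm', n', h'⟩
    refine ⟨m ⊕ₘ m', I.oplus_mem _ _ hm hm', n + n', (oplus_le_oplus h h').trans_eq ?_⟩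
    rw [nmul_add]; ac_rfl
  mem_of_le := fun y z h ⟨m, hm, n, h'⟩ => ⟨m, hm, n, h.trans h'⟩

/-- Adjoining `x` to `M` produces the improper ideal, so `1` lies below some `m ⊕ nx`. In the
quotient this is the hypothesis of Hölder's theorem. -/
theorem IsMaximal.exists_nmul {M : MVIdeal A} (hM : M.IsMaximal) {x : A} (hx : x ∉ M.carrier) :
    ∃ n, neg (nmul n x) ∈ M.carrier := by
  have hle : M.carrier ⊆ (M.adjoin x).carrier :=
    fun m hm => ⟨m, hm, 0, le_oplus_left _ _⟩
  have hxm : x ∈ (M.adjoin x).carrier :=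
    ⟨zero, M.zero_mem, 1, by rw [zero_oplus, nmul_one]⟩
  have hp : ¬ (M.adjoin x).IsProper := fun hp => hx (hM.2 _ hp hle ▸ hxm)
  rw [isProper_iff, not_not] at hp
  obtain ⟨m, hm, n, h⟩ := hp
  refine ⟨n, M.mem_of_le _ m ?_ hm⟩
  rw [le_iff, MVAlgebra.neg_neg, oplus_comm]
  exact eq_one_of_le h

theorem IsMaximal.zero_ne_one {M : MVIdeal A} (hM : M.IsMaximal) :
    (zero : M.Quo) ≠ neg zero := fun h =>
  (M.isProper_iff.1 hM.1) (M.proj_eq_zero_iff.1 h.symm)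

theorem IsMaximal.quo_exists_nmul {M : MVIdeal A} (hM : M.IsMaximal) (q : M.Quo)
    (hq : q ≠ zero) : ∃ n, nmul n q = neg zero := by
  obtain ⟨x, rfl⟩ := M.proj_surjective q
  obtain ⟨n, hn⟩ := hM.exists_nmul fun h => hq (M.proj_eq_zero_iff.2 h)
  refine ⟨n, neg_inj ?_⟩
  rw [MVAlgebra.neg_neg, ← M.proj_eq_zero_iff.2 hn]
  exact congrArg neg (M.projHom.map_nmul n x).symm

theorem isSimpleMV_quo {M : MVIdeal A} (hM : M.IsMaximal) : IsSimpleMV M.Quo := by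
  intro I
  constructor
  · intro hI
    refine Set.eq_singleton_iff_unique_mem.2 ⟨I.zero_mem, fun q hq => ?_⟩
    by_contra hne
    obtain ⟨n, hn⟩ := hM.quo_exists_nmul q hne
    exact I.isProper_iff.1 hI (hn ▸ I.nmul_mem hq n)
  · intro hI
    rw [isProper_iff, hI]
    exact fun h => hM.zero_ne_one h.symm

/-- Every proper ideal is contained in a maximal ideal. -/
theorem exists_le_maximal (I : MVIdeal A) (hI : I.IsProper) :
    ∃ M : MVIdeal A, M.IsMaximal ∧ I.carrier ⊆ M.carrier := by
  obtain ⟨S, hIS, hS⟩ := zorn_subset_nonempty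
    {s : Set A | ∃ J : MVIdeal A, J.IsProper ∧ J.carrier = s} (by
      intro c hc hchain hne
      have hmem : ∀ s ∈ c, ∃ J : MVIdeal A, J.IsProper ∧ J.carrier = s := fun s hs => hc hs
      refine ⟨⋃₀ c, ⟨⟨⋃₀ c, ?_, ?_, ?_⟩, ?_, rfl⟩, fun s hs => Set.subset_sUnion_of_mem hs⟩
      · obtain ⟨s, hs⟩ := hne
        obtain ⟨J, -, rfl⟩ := hmem s hs
        exact ⟨_, hs, J.zero_mem⟩
      · rintro x y ⟨s, hs, hx⟩ ⟨t, ht, hy⟩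
        rcases hchain.total hs ht with hst | hst
        · obtain ⟨J, -, rfl⟩ := hmem t ht
          exact ⟨_, ht, J.oplus_mem _ _ (hst hx) hy⟩
        · obtain ⟨J, -, rfl⟩ := hmem s hs
          exact ⟨_, hs, J.oplus_mem _ _ hx (hst hy)⟩
      · rintro x y hxy ⟨s, hs, hy⟩
        obtain ⟨J, -, rfl⟩ := hmem s hs
        exact ⟨_, hs, J.mem_of_le _ _ hxy hy⟩
      · rw [isProper_iff]
        rintro ⟨s, hs, hx⟩
        obtain ⟨J, hJ, rfl⟩ := hmem s hs
        exact J.isProper_iff.1 hJ hx) I.carrier ⟨I, hI, rfl⟩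
  obtain ⟨M, hM, rfl⟩ := hS.prop
  exact ⟨M, ⟨hM, fun J hJ hle => (hS.eq_of_subset ⟨J, hJ, rfl⟩ hle).symm⟩, hIS⟩

end MVIdeal

/-- The Archimedean property of the reals: if `g x > 0`, some multiple of `x` goes to `1`, its
negation lies in the kernel, and a larger ideal containing `x` contains `1`. -/
theorem MVHom.ker_isMaximal {A : Type u} [MVAlgebra A] (g : MVHom A unitInterval) :
    g.ker.IsMaximal := by
  constructor
  · rw [MVIdeal.isProper_iff]
    intro h
    have h1 : g (neg zero) = zero := h
    rw [g.map_neg, g.map_zero] at h1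
    have := congrArg Subtype.val h1
    rw [MVAlgebra.coe_neg, coe_zero] at this
    norm_num at this
  · intro J hJ hle
    refine Set.Subset.antisymm (fun x hx => ?_) hle
    by_contra hne
    have hpos : 0 < (g x : ℝ) := lt_of_le_of_ne (g x).2.1 fun h => hne (Subtype.ext h.symm)
    obtain ⟨n, hn⟩ := exists_nat_gt (1 / (g x : ℝ))
    rw [div_lt_iff₀ hpos] at hn
    have h1 : neg (nmul n x) ∈ J.carrier := hle (Subtype.ext (by
      rw [g.map_neg, g.map_nmul, MVAlgebra.coe_neg, coe_nmul, coe_zero, min_eq_left hn.le, sub_self]))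
    refine J.isProper_iff.1 hJ ?_
    have := J.oplus_mem _ _ h1 (J.nmul_mem hx n)
    rwa [(le_iff _ _).1 le_rfl] at this

/-! ### Points of the maximal spectrum as homomorphisms; semisimplicity. -/

section Hat

variable {A : Type u} [MVAlgebra A]

theorem maxEmbedding_spec (M : MaxSpec A) : Function.Injective (maxEmbedding M) ∧
    ∃ h : MVHom M.1.Quo unitInterval, h.toFun = maxEmbedding M := by
  obtain ⟨g, hg⟩ := exists_injective_hom M.2.zero_ne_one M.2.quo_exists_nmul
  exact Classical.epsilon_spec (p := fun f : M.1.Quo → unitInterval =>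
    Function.Injective f ∧ ∃ h : MVHom M.1.Quo unitInterval, h.toFun = f) ⟨g, hg, g, rfl⟩

/-- The homomorphism `a ↦ â`. -/
noncomputable def hatHom (A : Type u) [MVAlgebra A] : MVHom A (MaxSpec A → unitInterval) :=
  MVHom.pi fun M => (maxEmbedding_spec M).2.choose.comp M.1.projHom

theorem hatHom_apply (a : A) : hatHom A a = hat a :=
  funext fun M => congrFun (maxEmbedding_spec M).2.choose_spec (M.1.proj a)

/-- The value `â M`, as a homomorphism in `a`. -/
noncomputable def hatAt (M : MaxSpec A) : MVHom A unitInterval :=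
  (MVHom.eval (fun _ => unitInterval) M).comp (hatHom A)

theorem hatAt_apply (M : MaxSpec A) (a : A) : hatAt M a = hat a M :=
  congrFun (hatHom_apply a) M

theorem hatAt_eq_zero_iff (M : MaxSpec A) (a : A) : hatAt M a = zero ↔ a ∈ M.1.carrier := by
  rw [← M.1.proj_eq_zero_iff, ← (maxEmbedding_spec M).1.eq_iff, hatAt_apply]
  obtain ⟨h, hh⟩ := (maxEmbedding_spec M).2
  rw [← hh, h.map_zero, hh]
  rfl

/-- The point of the maximal spectrum given by a homomorphism to the unit interval. -/
noncomputable def MVHom.point (g : MVHom A unitInterval) : MaxSpec A := ⟨g.ker, g.ker_isMaximal⟩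

theorem hatAt_point (g : MVHom A unitInterval) : hatAt g.point = g :=
  (MVHom.ext_of_ker fun a h => (hatAt_eq_zero_iff g.point a).2 h).symm

theorem hat_point (g : MVHom A unitInterval) (a : A) : hat a g.point = g a := by
  rw [← hatAt_apply, hatAt_point]

end Hat

/-- An MV-algebra is semisimple if and only if the homomorphisms to the unit interval separate its
elements from `0`. -/
theorem isSemisimpleMV_iff {A : Type u} [MVAlgebra A] : IsSemisimpleMV A ↔
    ∀ a : A, (∀ g : MVHom A unitInterval, g a = zero) → a = zero := by
  constructor
  · rintro ⟨X, S, f, hf, hS⟩ a ha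
    refine hf (funext fun i => ?_)
    rw [f.map_zero]
    let I : MVIdeal (S i) := ⟨{zero}, rfl, by rintro _ _ rfl rfl; exact oplus_zero _,
      by rintro x _ h rfl; exact eq_zero_of_le h⟩
    -- Simplicity of `S i` makes the zero ideal maximal, so Hölder's theorem applies to `S i`
    -- itself.
    have hI : I.IsMaximal := ⟨((hS i).1 I).2 rfl, fun J hJ _ => ((hS i).1 J).1 hJ⟩
    obtain ⟨g, hg⟩ := exists_injective_hom (A := S i)
      (fun h => I.isProper_iff.1 hI.1 h.symm) (fun q hq => by
        obtain ⟨n, hn⟩ := hI.exists_nmul (x := q) hq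
        exact ⟨n, by rw [← show neg (nmul n q) = zero from hn, MVAlgebra.neg_neg]⟩)
    refine hg ?_
    exact (ha ((g.comp (MVHom.eval (fun i => S i) i)).comp f)).trans g.map_zero.symm
  · intro h
    have hle : ∀ a b : A, (∀ M : MaxSpec A, M.1.proj a = M.1.proj b) → a ≤ b := by
      intro a b hab
      refine ominus_eq_zero_iff.1 (h _ fun g => ?_)
      exact (MVIdeal.proj_eq_iff _ |>.1 (hab g.point)).1
    refine ⟨MaxSpec A, fun M => MVAlg.mk M.1.Quo, MVHom.pi fun M => M.1.projHom, fun a b hab => ?_,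
      fun M => ⟨MVIdeal.isSimpleMV_quo M.2, M.1.proj_surjective⟩⟩
    exact le_antisymm (hle a b fun M => congrFun hab M) (hle b a fun M => (congrFun hab M).symm)

namespace IsSemisimpleMV

variable {A : Type u} [MVAlgebra A]

theorem le_of_forall (hA : IsSemisimpleMV A) {a b : A}
    (h : ∀ g : MVHom A unitInterval, g a ≤ g b) : a ≤ b :=
  ominus_eq_zero_iff.1 (isSemisimpleMV_iff.1 hA _ fun g => by
    rw [g.map_ominus, ominus_eq_zero_iff]; exact h g)

theorem eq_of_forall (hA : IsSemisimpleMV A) {a b : A}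
    (h : ∀ g : MVHom A unitInterval, g a = g b) : a = b :=
  le_antisymm (hA.le_of_forall fun g => (h g).le) (hA.le_of_forall fun g => (h g).ge)

theorem hat_injective (hA : IsSemisimpleMV A) : Function.Injective (hat : A → _) :=
  fun a b h => hA.eq_of_forall fun g => by rw [← hat_point, ← hat_point, h]

end IsSemisimpleMV

/-! ### Limit cuts as uniformly Cauchy cuts. -/

section LimitCut

variable {A : Type u} [MVAlgebra A] {X : Set A}

theorem IsCut.join_mem (hX : IsCut X) {a b : A} (ha : a ∈ X) (hb : b ∈ X) : join a b ∈ X := by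
  rw [hX]; exact fun c hc => join_le (hc ha) (hc hb)

theorem IsCut.zero_mem (hX : IsCut X) : zero ∈ X := by
  rw [hX]; exact fun c _ => MVAlgebra.zero_le c

theorem meet_mem_upperBounds {b c : A} (hb : b ∈ upperBounds X) (hc : c ∈ upperBounds X) :
    meet b c ∈ upperBounds X := fun _ ha => le_meet (hb ha) (hc ha)

/-- A limit cut is a Cauchy cut. -/
theorem IsLimitCut.exists_sub_le (hX : IsLimitCut X) {ε : ℝ} (hε : 0 < ε) :
    ∃ a ∈ X, ∃ b ∈ upperBounds X, ∀ g : MVHom A unitInterval, (g b : ℝ) - g a ≤ ε := by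
  obtain ⟨m, hm⟩ := exists_nat_one_div_lt hε
  set n := m + 1
  have hn : (0 : ℝ) < n := by positivity
  have hn1 : (1 : ℝ) ≤ n := by simp [n]
  have hmε : 1 / (n : ℝ) < ε := by simpa [n] using hm
  -- A compactness argument. The elements `neg (n (b ⊖ a))` form a directed family, by joins in `X`
  -- and meets in `uX`, so the ideal they generate is described by one pair at a time. A point of
  -- the spectrum containing this ideal is one where every `b̂ ⊖ â` is at least `1/n`.
  let J : MVIdeal A :=
    { carrier := {y | ∃ a ∈ X, ∃ b ∈ upperBounds X, ∃ k, y ≤ nmul k (neg (nmul n (ominus b a)))}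
      zero_mem := ⟨zero, hX.1.zero_mem, neg zero, fun _ _ => MVAlgebra.le_one _, 0,
        MVAlgebra.zero_le _⟩
      oplus_mem := by
        rintro y z ⟨a, ha, b, hb, k, h⟩ ⟨a', ha', b', hb', k', h'⟩
        refine ⟨join a a', hX.1.join_mem ha ha', meet b b', meet_mem_upperBounds hb hb', k + k', ?_⟩
        rw [nmul_add]
        refine oplus_le_oplus (h.trans (nmul_mono _ (neg_anti (nmul_mono _ ?_))))
          (h'.trans (nmul_mono _ (neg_anti (nmul_mono _ ?_))))
        · exact (ominus_mono (meet_le_left _ _) _).trans (ominus_anti _ (le_join_left _ _))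
        · exact (ominus_mono (meet_le_right _ _) _).trans (ominus_anti _ (le_join_right _ _))
      mem_of_le := fun y z h ⟨a, ha, b, hb, k, h'⟩ => ⟨a, ha, b, hb, k, h.trans h'⟩ }
  by_cases hJ : J.IsProper
  · exfalso
    obtain ⟨M, hM, hJM⟩ := J.exists_le_maximal hJ
    let P : MaxSpec A := ⟨M, hM⟩
    let r : unitInterval := ⟨1 / n, by positivity, by rw [div_le_one hn]; exact hn1⟩
    classical
    -- The function equal to `1/n` at `P` and `0` elsewhere is a lower bound, which contradicts the
    -- infimum being `0`.
    have hlb : Function.update (fun _ => zero) P r ∈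
        lowerBounds {f : MaxSpec A → unitInterval |
          ∃ a ∈ X, ∃ b ∈ upperBounds X, f = ominus (hat b) (hat a)} := by
      rintro _ ⟨a, ha, b, hb, rfl⟩ Q
      by_cases hQ : Q = P
      · subst hQ
        rw [Function.update_self]
        have h1 : neg (nmul n (ominus b a)) ∈ M.carrier :=
          hJM ⟨a, ha, b, hb, 1, (nmul_one _).ge⟩
        have h2 := congrArg Subtype.val ((hatAt_eq_zero_iff P _).2 h1)
        rw [MVHom.map_neg, MVHom.map_nmul, MVHom.map_ominus, MVAlgebra.coe_neg, coe_nmul,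
          coe_zero] at h2
        have h3 := min_le_right 1 ((n : ℝ) * (ominus (hatAt P b) (hatAt P a) : unitInterval))
        have h4 : 1 / (n : ℝ) ≤ (ominus (hatAt P b) (hatAt P a) : unitInterval) := by
          rw [div_le_iff₀ hn]; linarith
        rw [hatAt_apply, hatAt_apply] at h4
        exact h4
      · rw [Function.update_of_ne hQ]
        exact MVAlgebra.zero_le _
    have h5 := hX.2.2 hlb P
    rw [Function.update_self] at h5
    have h6 : 1 / (n : ℝ) ≤ 0 := h5
    have : 0 < 1 / (n : ℝ) := by positivity
    linarith
  · rw [MVIdeal.isProper_iff, not_not] at hJ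
    obtain ⟨a, ha, b, hb, k, hk⟩ := hJ
    refine ⟨a, ha, b, hb, fun g => ?_⟩
    -- A gap larger than `1/n` would make `g` kill `neg (n (b ⊖ a))`, some multiple of which is `1`.
    by_contra! hlt
    have h1 : 1 ≤ (n : ℝ) * (ominus (g b) (g a) : unitInterval) := by
      rw [coe_ominus, ← div_le_iff₀' hn]
      exact (hmε.trans hlt).le.trans (le_max_right _ _)
    have h2 := g.mono hk
    rw [g.map_neg, g.map_zero, g.map_nmul, g.map_neg, g.map_nmul, g.map_ominus] at h2
    have h3 : (1 - 0 : ℝ) ≤ _ := h2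
    rw [coe_nmul, MVAlgebra.coe_neg, coe_nmul, min_eq_left h1] at h3
    norm_num at h3

theorem IsCut.isLimitCut (hX : IsCut X) (h : ∀ ε : ℝ, 0 < ε →
    ∃ a ∈ X, ∃ b ∈ upperBounds X, ∀ g : MVHom A unitInterval, (g b : ℝ) - g a ≤ ε) :
    IsLimitCut X := by
  refine ⟨hX, fun f _ => MVAlgebra.zero_le f, fun f hf M => ?_⟩
  change (f M : ℝ) ≤ 0
  refine le_of_forall_pos_le_add fun ε hε => ?_
  obtain ⟨a, ha, b, hb, hab⟩ := h ε hε
  have h1 : (f M : ℝ) ≤ (ominus (hat b M) (hat a M) : unitInterval) := hf ⟨a, ha, b, hb, rfl⟩ M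
  have h2 := hab (hatAt M)
  rw [hatAt_apply, hatAt_apply] at h2
  rw [coe_ominus] at h1
  rw [zero_add]
  exact h1.trans (max_le hε.le h2)

/-- A limit cut determines at most one value in between its images. -/
theorem IsLimitCut.eq_of_between (hX : IsLimitCut X) (g : MVHom A unitInterval)
    {r s : unitInterval} (hr : ∀ a ∈ X, g a ≤ r) (hr' : ∀ b ∈ upperBounds X, r ≤ g b)
    (hs : ∀ a ∈ X, g a ≤ s) (hs' : ∀ b ∈ upperBounds X, s ≤ g b) : r = s := by
  refine Subtype.ext (eq_of_forall_dist_le fun ε hε => ?_)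
  obtain ⟨a, ha, b, hb, hab⟩ := hX.exists_sub_le hε
  have h1 : (g a : ℝ) ≤ r := hr a ha
  have h2 : (g a : ℝ) ≤ s := hs a ha
  have h3 : (r : ℝ) ≤ g b := hr' b hb
  have h4 : (s : ℝ) ≤ g b := hs' b hb
  rw [Real.dist_eq, abs_le]
  constructor <;> linarith [hab g]

variable {B : Type v} [MVAlgebra B]

/-- The image of a limit cut in a limit cut complete algebra is interpolated by an element. -/
theorem IsLimitCut.exists_between (hX : IsLimitCut X) (φ : MVHom A B)
    (hB : IsLimitCutComplete B) :
    ∃ s : B, (∀ a ∈ X, φ a ≤ s) ∧ ∀ b ∈ upperBounds X, s ≤ φ b := by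
  set Y := lowerBounds (upperBounds (φ.toFun '' X)) with hY
  have hsub : φ.toFun '' X ⊆ Y := fun y hy _ hc => hc hy
  have hub : ∀ b ∈ upperBounds X, φ b ∈ upperBounds (φ.toFun '' X) := by
    rintro b hb _ ⟨a, ha, rfl⟩
    exact φ.mono (hb ha)
  have hub' : ∀ c ∈ upperBounds (φ.toFun '' X), c ∈ upperBounds Y := fun c hc y hy => hy hc
  have hcut : IsCut Y := Set.Subset.antisymm (fun y hy _ hc => hc hy)
    (fun y hy c hc => hy (hub' c hc))
  -- The cut generated by the image is Cauchy because each `g : B → [0,1]` restricts to the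
  -- homomorphism `g ∘ φ` on `A`.
  obtain ⟨s, hs⟩ := hB.2 Y (hcut.isLimitCut fun ε hε => by
    obtain ⟨a, ha, b, hb, hab⟩ := hX.exists_sub_le hε
    exact ⟨φ a, hsub ⟨a, ha, rfl⟩, φ b, hub' _ (hub b hb), fun g => hab (g.comp φ)⟩)
  exact ⟨s, fun a ha => hs.1 (hsub ⟨a, ha, rfl⟩), fun b hb => hs.2 (hub' _ (hub b hb))⟩

end LimitCut

/-- The inclusion of a subalgebra. -/
def MVSubalgebra.incl {A : Type u} [MVAlgebra A] (B : MVSubalgebra A) : MVHom B.carrier A :=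
  ⟨Subtype.val, rfl, fun _ _ => rfl, fun _ => rfl⟩

/-! ### Subalgebras of `[0,1]^Y`, and factorization of homomorphisms. -/

section FunctionAlgebra

variable {Y : Type v}

/-- Evaluation at a point, for an algebra of functions. -/
noncomputable def MVSubalgebra.evalAt (L : MVSubalgebra (Y → unitInterval)) (y : Y) :
    MVHom L.carrier unitInterval := (MVHom.eval (fun _ => unitInterval) y).comp L.incl

theorem MVSubalgebra.isSemisimpleMV (L : MVSubalgebra (Y → unitInterval)) :
    IsSemisimpleMV L.carrier :=
  isSemisimpleMV_iff.2 fun _ ha => Subtype.ext (funext fun y => ha (L.evalAt y))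

/-- An algebra of functions is limit cut complete if it contains all functions interpolating a
limit cut. -/
theorem MVSubalgebra.isLimitCutComplete (L : MVSubalgebra (Y → unitInterval))
    (h : ∀ X : Set L.carrier, IsLimitCut X → ∀ f : Y → unitInterval, (∀ a ∈ X, a.1 ≤ f) →
      (∀ b ∈ upperBounds X, f ≤ b.1) → f ∈ L.carrier) : IsLimitCutComplete L.carrier := by
  refine ⟨L.isSemisimpleMV, fun X hX => ?_⟩
  have hbdd : ∀ y, BddAbove ((fun a : L.carrier => (a.1 y : ℝ)) '' X) := fun y =>
    ⟨1, by rintro _ ⟨a, -, rfl⟩; exact (a.1 y).2.2⟩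
  have hz : ∀ y, (0 : ℝ) ∈ (fun a : L.carrier => (a.1 y : ℝ)) '' X := fun y =>
    ⟨zero, hX.1.zero_mem, rfl⟩
  let f : Y → unitInterval := fun y => ⟨sSup ((fun a : L.carrier => (a.1 y : ℝ)) '' X),
    le_csSup (hbdd y) (hz y), csSup_le ⟨0, hz y⟩ (by rintro _ ⟨a, -, rfl⟩; exact (a.1 y).2.2)⟩
  have h1 : ∀ a ∈ X, a.1 ≤ f := fun a ha y => le_csSup (hbdd y) ⟨a, ha, rfl⟩
  have h2 : ∀ b ∈ upperBounds X, f ≤ b.1 := fun b hb y => csSup_le ⟨0, hz y⟩ (by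
    rintro _ ⟨a, ha, rfl⟩
    exact hb ha y)
  exact ⟨⟨f, h X hX f h1 h2⟩, fun a ha => h1 a ha, fun b hb => h2 b hb⟩

end FunctionAlgebra

/-- The inclusion of a subalgebra into a larger one. -/
def MVSubalgebra.inclusion {A : Type u} [MVAlgebra A] {L B : MVSubalgebra A}
    (h : L.carrier ⊆ B.carrier) : MVHom L.carrier B.carrier :=
  ⟨fun x => ⟨x.1, h x.2⟩, rfl, fun _ _ => rfl, fun _ => rfl⟩

section

variable {A : Type u} {C : Type v} {D : Type w} [MVAlgebra A] [MVAlgebra C] [MVAlgebra D]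

/-- The inverse image of the range of a homomorphism. -/
def MVHom.comapRange (h : MVHom A D) (i : MVHom C D) : MVSubalgebra A where
  carrier := {a | ∃ c, i c = h a}
  zero_mem := ⟨zero, by rw [i.map_zero, h.map_zero]⟩
  oplus_mem := by
    rintro x y ⟨c, hc⟩ ⟨d, hd⟩
    exact ⟨c ⊕ₘ d, by rw [i.map_oplus, h.map_oplus, hc, hd]⟩
  neg_mem := by
    rintro x ⟨c, hc⟩
    exact ⟨neg c, by rw [i.map_neg, h.map_neg, hc]⟩

/-- The subalgebra of the elements at which two homomorphisms on a subalgebra agree. -/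
def MVHom.equalizer {L : MVSubalgebra A} (g h : MVHom L.carrier C) : MVSubalgebra A where
  carrier := {a | ∃ ha : a ∈ L.carrier, g ⟨a, ha⟩ = h ⟨a, ha⟩}
  zero_mem := ⟨L.zero_mem, g.map_zero.trans h.map_zero.symm⟩
  oplus_mem := by
    rintro x y ⟨hx, hx'⟩ ⟨hy, hy'⟩
    refine ⟨L.oplus_mem _ _ hx hy, (g.map_oplus ⟨x, hx⟩ ⟨y, hy⟩).trans ?_⟩
    rw [hx', hy']
    exact (h.map_oplus ⟨x, hx⟩ ⟨y, hy⟩).symm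
  neg_mem := by
    rintro x ⟨hx, hx'⟩
    refine ⟨L.neg_mem _ hx, (g.map_neg ⟨x, hx⟩).trans ?_⟩
    rw [hx']
    exact (h.map_neg ⟨x, hx⟩).symm

/-- A homomorphism whose values are in the range of an embedding factors through it. -/
noncomputable def MVHom.factor (h : MVHom A D) (i : MVHom C D) (hi : Function.Injective i)
    (hr : ∀ a, ∃ c, i c = h a) : MVHom A C where
  toFun a := (hr a).choose
  map_zero := hi (by rw [(hr _).choose_spec, h.map_zero, i.map_zero])
  map_oplus x y := hi (by
    rw [(hr _).choose_spec, h.map_oplus, i.map_oplus, (hr _).choose_spec, (hr _).choose_spec])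
  map_neg x := hi (by rw [(hr _).choose_spec, h.map_neg, i.map_neg, (hr _).choose_spec])

theorem MVHom.factor_spec (h : MVHom A D) (i : MVHom C D) (hi : Function.Injective i)
    (hr : ∀ a, ∃ c, i c = h a) (a : A) : i (h.factor i hi hr a) = h a := (hr a).choose_spec

end

/-! ### The universal property of the limit cut completion. -/

section Completion

variable (A : Type u) [MVAlgebra A]

/-- A limit cut of the intersection is interpolated in each member `B` by an element of `B`.
Interpolants are unique at every point, so these elements are all the same function. -/
theorem lcCompletion_isLimitCutComplete : IsLimitCutComplete (lcCompletion A).carrier := by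
  refine MVSubalgebra.isLimitCutComplete _ fun X hX f hf hf' B hB hA => ?_
  obtain ⟨s, hs, hs'⟩ := hX.exists_between
    (MVSubalgebra.inclusion (B := B) fun f hf => hf B hB hA) hB
  suffices f = s.1 by rw [this]; exact s.2
  exact funext fun y => hX.eq_of_between ((lcCompletion A).evalAt y) (fun a ha => hf a ha y)
    (fun b hb => hf' b hb y) (fun a ha => hs a ha y) (fun b hb => hs' b hb y)

/-- The homomorphism `a ↦ â` into the limit cut completion. -/
noncomputable def toCompletion : MVHom A (lcCompletion A).carrier where
  toFun a := ⟨hat a, fun _ _ h => h a⟩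
  map_zero := Subtype.ext (show hat zero = zero by rw [← hatHom_apply, (hatHom A).map_zero])
  map_oplus x y := Subtype.ext (show hat (x ⊕ₘ y) = hat x ⊕ₘ hat y by
    simp only [← hatHom_apply, (hatHom A).map_oplus])
  map_neg x := Subtype.ext (show hat (neg x) = neg (hat x) by
    simp only [← hatHom_apply, (hatHom A).map_neg])

variable {A} {C : Type v} [MVAlgebra C]

/-- The homomorphism of function algebras induced by a homomorphism, through the map it induces on
maximal spectra. -/
noncomputable def MVHom.onFunctions (φ : MVHom A C) :
    MVHom (MaxSpec A → unitInterval) (MaxSpec C → unitInterval) :=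
  MVHom.pi fun N => MVHom.eval (fun _ => unitInterval) ((hatAt N).comp φ).point

theorem MVHom.onFunctions_hat (φ : MVHom A C) (a : A) : φ.onFunctions (hat a) = hat (φ a) :=
  funext fun N => (hat_point ((hatAt N).comp φ) a).trans (hatAt_apply N (φ a))

theorem MVHom.comapRange_isLimitCutComplete (φ : MVHom A C) (hC : IsLimitCutComplete C) :
    IsLimitCutComplete (φ.onFunctions.comapRange (hatHom C)).carrier := by
  refine MVSubalgebra.isLimitCutComplete _ fun X hX f hf hf' => ?_
  set B := φ.onFunctions.comapRange (hatHom C)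
  have hinj : Function.Injective (hatHom C) := fun a b h => hC.1.hat_injective (by
    rwa [hatHom_apply, hatHom_apply] at h)
  let ψ : MVHom B.carrier C := (φ.onFunctions.comp B.incl).factor (hatHom C) hinj fun a => a.2
  have hψ : ∀ b, hatHom C (ψ b) = φ.onFunctions b.1 := MVHom.factor_spec _ _ hinj _
  obtain ⟨s, hs, hs'⟩ := hX.exists_between ψ hC
  refine ⟨s, funext fun N => ?_⟩
  -- At each `N` the values of `ŝ` and of the pullback of `f` interpolate the same cut, evaluated at
  -- the image of `N` in `Max A`.
  refine hX.eq_of_between (B.evalAt ((hatAt N).comp φ).point) (fun a ha => ?_) (fun b hb => ?_)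
    (fun a ha => hf a ha _) (fun b hb => hf' b hb _)
  · have := (hatHom C).mono (hs a ha) N
    rw [hψ] at this
    exact this
  · have := (hatHom C).mono (hs' b hb) N
    rw [hψ] at this
    exact this

/-- The extension of a homomorphism to the limit cut completion. -/
theorem exists_completion_lift (φ : MVHom A C) (hC : IsLimitCutComplete C) :
    ∃ ψ : MVHom (lcCompletion A).carrier C, ψ.comp (toCompletion A) = φ := by
  have hinj : Function.Injective (hatHom C) := fun a b h => hC.1.hat_injective (by
    rwa [hatHom_apply, hatHom_apply] at h)
  have hr : ∀ f : (lcCompletion A).carrier,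
      ∃ c, hatHom C c = (φ.onFunctions.comp (lcCompletion A).incl) f := fun f =>
    f.2 _ (φ.comapRange_isLimitCutComplete hC) fun a =>
      ⟨φ a, by rw [φ.onFunctions_hat, hatHom_apply]⟩
  refine ⟨(φ.onFunctions.comp (lcCompletion A).incl).factor (hatHom C) hinj hr, ?_⟩
  ext a
  refine hinj ((MVHom.factor_spec _ _ hinj hr _).trans ?_)
  rw [hatHom_apply]
  exact φ.onFunctions_hat a

/-- The equalizer of `g` and `h` contains every `â` and is limit cut complete, so by minimality it
is all of `A^lcc`. Completeness holds because `k (g s)` and `k (h s)` interpolate the same cut, for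
each `k : C → [0,1]`. -/
theorem completion_hom_ext {g h : MVHom (lcCompletion A).carrier C} (hC : IsLimitCutComplete C)
    (hgh : g.comp (toCompletion A) = h.comp (toCompletion A)) : g = h := by
  let E := MVHom.equalizer g h
  have hE : IsLimitCutComplete E.carrier := by
    refine E.isLimitCutComplete fun X hX f hf hf' => ?_
    let j : MVHom E.carrier (lcCompletion A).carrier :=
      MVSubalgebra.inclusion fun f hf => hf.1
    have hgj : ∀ e, g (j e) = h (j e) := fun e => e.2.2
    obtain ⟨s, hs, hs'⟩ := hX.exists_between j (lcCompletion_isLimitCutComplete A)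
    have hfs : f = s.1 := funext fun y => hX.eq_of_between (E.evalAt y) (fun a ha => hf a ha y)
      (fun b hb => hf' b hb y) (fun a ha => hs a ha y) (fun b hb => hs' b hb y)
    subst hfs
    refine ⟨s.2, hC.1.eq_of_forall fun k => ?_⟩
    refine hX.eq_of_between ((k.comp g).comp j) (fun a ha => (k.comp g).mono (hs a ha))
      (fun b hb => (k.comp g).mono (hs' b hb)) (fun a ha => ?_) (fun b hb => ?_)
    · refine (congrArg k (hgj a)).trans_le ((k.comp h).mono (hs a ha))
    · refine ((k.comp h).mono (hs' b hb)).trans_eq (congrArg k (hgj b)).symm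
  ext f
  obtain ⟨_, hf⟩ := f.2 E hE fun a => ⟨(toCompletion A a).2,
    congrArg (fun k : MVHom A C => k a) hgh⟩
  exact hf

end Completion

/-! ### The semisimple reflection. -/

section Radical

variable (A : Type u) [MVAlgebra A]

theorem isSemisimpleMV_quo_radical : IsSemisimpleMV (MVIdeal.radical A).Quo := by
  refine isSemisimpleMV_iff.2 fun q hq => ?_
  obtain ⟨a, rfl⟩ := MVIdeal.proj_surjective _ q
  refine (MVIdeal.proj_eq_zero_iff _).2 fun M hM => ?_
  -- Each evaluation at a maximal ideal factors through `A/Rad A`, so these evaluations already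
  -- separate its elements from zero.
  have h : ∀ a ∈ (MVIdeal.radical A).carrier, hatAt ⟨M, hM⟩ a = zero := fun a ha =>
    (hatAt_eq_zero_iff ⟨M, hM⟩ a).2 (ha M hM)
  exact (hatAt_eq_zero_iff ⟨M, hM⟩ a).1 (hq (MVIdeal.lift _ _ h))

variable {A} {C : Type v} [MVAlgebra C]

theorem map_eq_zero_of_mem_radical (φ : MVHom A C) (hC : IsSemisimpleMV C) :
    ∀ a ∈ (MVIdeal.radical A).carrier, φ a = zero := fun _ ha =>
  isSemisimpleMV_iff.1 hC _ fun g => ha _ (g.comp φ).ker_isMaximal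

end Radical

/-! ### From universal arrows to the adjunctions. -/

section UniversalArrow

universe v₁ v₂ u₁ u₂

variable {𝒞 : Type u₁} [Category.{v₁} 𝒞] {𝒟 : Type u₂} [Category.{v₂} 𝒟] {G : 𝒟 ⥤ 𝒞}
  {F : 𝒞 → 𝒟} (η : ∀ A, A ⟶ G.obj (F A))
  (hη : ∀ A Y, Function.Bijective fun g : F A ⟶ Y => η A ≫ G.map g)

/-- The bijection of hom-sets given by a universal arrow. -/
noncomputable def universalArrowEquiv (A : 𝒞) (Y : 𝒟) : (F A ⟶ Y) ≃ (A ⟶ G.obj Y) :=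
  Equiv.ofBijective _ (hη A Y)

theorem universalArrowEquiv_comp (A : 𝒞) (Y Y' : 𝒟) (g : Y ⟶ Y') (h : F A ⟶ Y) :
    universalArrowEquiv η hη A Y' (h ≫ g) = universalArrowEquiv η hη A Y h ≫ G.map g := by
  simp [universalArrowEquiv]

/-- The left adjoint given by universal arrows. -/
noncomputable def universalArrowFunctor : 𝒞 ⥤ 𝒟 :=
  Adjunction.leftAdjointOfEquiv (universalArrowEquiv η hη) (universalArrowEquiv_comp η hη)

/-- The adjunction given by universal arrows. -/
noncomputable def universalArrowAdjunction : universalArrowFunctor η hη ⊣ G :=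
  Adjunction.adjunctionOfEquivLeft _ _

theorem universalArrowAdjunction_unit_app (A : 𝒞) :
    (universalArrowAdjunction η hη).unit.app A = η A := by
  refine (Adjunction.adjunctionOfEquivLeft_unit_app _ _ A).trans ?_
  change η A ≫ G.map (𝟙 (F A)) = η A
  rw [G.map_id, Category.comp_id]

end UniversalArrow

theorem semisimple_arrow_bijective (A : MVAlg.{u}) (Y : MVss.{u}.FullSubcategory) :
    Function.Bijective fun g : (⟨MVAlg.mk (MVIdeal.radical A).Quo, isSemisimpleMV_quo_radical A⟩ :
      MVss.{u}.FullSubcategory) ⟶ Y =>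
      (show A ⟶ MVAlg.mk (MVIdeal.radical A).Quo from (MVIdeal.radical A).projHom) ≫
        MVss.{u}.ι.map g := by
  constructor
  · intro g h hgh
    refine ObjectProperty.hom_ext _ (MVHom.ext (funext fun q => ?_))
    obtain ⟨a, rfl⟩ := MVIdeal.proj_surjective _ q
    exact congrArg (fun k : MVHom A Y.obj => k a) hgh
  · intro f
    exact ⟨ObjectProperty.homMk (MVIdeal.lift _ f (map_eq_zero_of_mem_radical f Y.property)), rfl⟩

theorem completion_arrow_bijective (A : MVss.{u}.FullSubcategory)
    (Y : MVlcc.{u}.FullSubcategory) :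
    Function.Bijective fun g : (⟨MVAlg.mk (lcCompletion A.obj).carrier,
        lcCompletion_isLimitCutComplete A.obj⟩ : MVlcc.{u}.FullSubcategory) ⟶ Y =>
      (show A ⟶ (ObjectProperty.ιOfLE MVlcc_le_MVss.{u}).obj
        ⟨MVAlg.mk (lcCompletion A.obj).carrier, lcCompletion_isLimitCutComplete A.obj⟩ from
          ObjectProperty.homMk (toCompletion A.obj)) ≫
        (ObjectProperty.ιOfLE MVlcc_le_MVss.{u}).map g := by
  constructor
  · intro g h hgh
    exact ObjectProperty.hom_ext _ (completion_hom_ext Y.property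
      (congrArg (fun k : A ⟶ (ObjectProperty.ιOfLE MVlcc_le_MVss.{u}).obj Y => k.hom) hgh))
  · intro f
    obtain ⟨ψ, hψ⟩ := exists_completion_lift (A := A.obj) (C := Y.obj) f.hom Y.property
    exact ⟨ObjectProperty.homMk ψ, ObjectProperty.hom_ext _ hψ⟩

/-- Limit cut complete MV-algebras form a reflective full subcategory of all MV-algebras, and
a reflector is the composite of `S : A ↦ A / Rad A` (the reflection onto semisimple MV-algebras,
with unit the canonical projection) with `K : A ↦ A^lcc` (with unit `a ↦ â`). -/
theorem corollary5p9 :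
    Nonempty (Reflective MVlcc.{u}.ι) ∧
    ∃ (S : MVAlg.{u} ⥤ MVss.{u}.FullSubcategory)
      (adjS : S ⊣ MVss.{u}.ι)
      (K : MVss.{u}.FullSubcategory ⥤ MVlcc.{u}.FullSubcategory)
      (adjK : K ⊣ ObjectProperty.ιOfLE MVlcc_le_MVss.{u})
      (adj : S ⋙ K ⊣ MVlcc.{u}.ι),
      (∀ A : MVAlg.{u}, ∃ e : (S.obj A).obj ≅ MVAlg.mk (MVIdeal.radical A).Quo,
        ∀ a : A, MVAlg.map (adjS.unit.app A ≫ e.hom) a = (MVIdeal.radical A).proj a) ∧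
      (∀ A : MVss.{u}.FullSubcategory,
        ∃ e : (K.obj A).obj ≅ MVAlg.mk (lcCompletion A.obj).carrier,
        ∀ a : A.obj, (MVAlg.map (MVss.{u}.ι.map (adjK.unit.app A) ≫ e.hom) a).1 = hat a) ∧
      (∀ A : MVAlg.{u},
        adj.unit.app A = adjS.unit.app A ≫ MVss.{u}.ι.map (adjK.unit.app (S.obj A))) := by
  let adjS := universalArrowAdjunction _ semisimple_arrow_bijective.{u}
  let adjK := universalArrowAdjunction _ completion_arrow_bijective.{u}
  -- The composite of the two inclusions agrees by definition with the inclusion into all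
  -- MV-algebras. The isomorphisms are identities because the left adjoints have the prescribed
  -- objects by construction.
  refine ⟨⟨{ L := _, adj := adjS.comp adjK }⟩, _, adjS, _, adjK, adjS.comp adjK, fun A => ?_,
    fun A => ?_, fun A => adjS.comp_unit_app adjK A⟩
  · refine ⟨Iso.refl _, fun a => ?_⟩
    rw [universalArrowAdjunction_unit_app]
    rfl
  · refine ⟨Iso.refl _, fun a => ?_⟩
    rw [universalArrowAdjunction_unit_app]
    rfl
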